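/- For $a,b\in\mathbb{Q}^\times$ let $H_{a,b}=\mathbb{Q}\cdot 1\oplus\mathbb{Q}\cdot\alpha\oplus\mathbb{Q}\cdot\beta\oplus\mathbb{Q}\cdot\alpha\beta$ be the quaternion algebra over $\mathbb{Q}$ with $\alpha^2=a$, $\beta^2=b$, $\alpha\beta=-\beta\alpha$. Let $\mathbb{P}$ be the set of rational primes, put $\mathbb{Q}_\infty:=\mathbb{R}$, and let $$\Delta_{a,b}:=\{p\in\mathbb{P}\cup\{\infty\} : H_{a,b}\otimes_{\mathbb{Q}}\mathbb{Q}_p\not\cong M_2(\mathbb{Q}_p)\text{ as }\mathbb{Q}_p\text{-algebras}\}$$ be the set of places where $H_{a,b}$ does not split. Let $$S_{a,b}:=\{2x_1 : x_1\in\mathbb{Q},\ \exists\, x_2,x_3,x_4\in\mathbb{Q}:\ x_1^2-ax_2^2-bx_3^2+abx_4^2=1\}$$ be the set of traces of norm-$1$ elements of $H_{a,b}$, and let $T_{a,b}:=S_{a,b}+S_{a,b}=\{s+s' : s,s'\in S_{a,b}\}$. For $p\in\mathbb{P}$ let $\mathbb{Z}_{(p)}\subseteq\mathbb{Q}$ be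 the set of rationals whose denominator in lowest terms is not divisible by $p$, and let $\mathbb{Z}_{(\infty)}:=\{x\in\mathbb{Q} : -4\le x\le 4\}$. **Proposition.** For all $a,b\in\mathbb{Q}^\times$, $$T_{a,b}=\bigcap_{p\in\Delta_{a,b}}\mathbb{Z}_{(p)},$$ where the empty intersection is understood to be $\mathbb{Q}$; that is, $T_{a,b}=\mathbb{Q}$ if $\Delta_{a,b}=\emptyset$. -/

import Mathlib

open scoped TensorProduct Quaternion Pointwise

/-- The places of `ℚ`, i.e. `ℙ ∪ {∞}`. -/
inductive RatPlace : Type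
  | infinite : RatPlace
  | finite (p : Nat.Primes) : RatPlace

/-- The rational quaternion algebra `H_{a,b} = ℚ·1 ⊕ ℚ·α ⊕ ℚ·β ⊕ ℚ·αβ` with
`α² = a`, `β² = b`, `αβ = -βα`. -/
abbrev RatQuaternion (a b : ℚ) : Type := ℍ[ℚ, a, b]

/-- `H_{a,b}` splits over the field `K ⊇ ℚ`: the base change of `H_{a,b}` to `K` is isomorphic,
as a `K`-algebra, to the algebra of `2 × 2` matrices over `K`. -/
def SplitsOver (a b : ℚ) (K : Type) [Field K] [Algebra ℚ K] : Prop :=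
  Nonempty ((K ⊗[ℚ] RatQuaternion a b) ≃ₐ[K] Matrix (Fin 2) (Fin 2) K)

/-- `H_{a,b}` splits at a place of `ℚ`, i.e. over the corresponding completion `ℝ` or `ℚ_p`. -/
def SplitsAt (a b : ℚ) : RatPlace → Prop
  | .infinite => SplitsOver a b ℝ
  | .finite p => haveI : Fact (p : ℕ).Prime := ⟨p.2⟩; SplitsOver a b ℚ_[(p : ℕ)]

/-- The set `Δ_{a,b}` of places of `ℚ` at which `H_{a,b}` does not split. -/
def ramifiedPlaces (a b : ℚ) : Set RatPlace := {v | ¬ SplitsAt a b v}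

/-- The set `S_{a,b}` of traces of norm-`1` elements of `H_{a,b}`. -/
def traceSet (a b : ℚ) : Set ℚ :=
  {t | ∃ x₁ x₂ x₃ x₄ : ℚ,
    x₁ ^ 2 - a * x₂ ^ 2 - b * x₃ ^ 2 + a * b * x₄ ^ 2 = 1 ∧ t = 2 * x₁}

/-- `S_{a,b}` is the set of `q + q̄` for `q ∈ H_{a,b}` with `q q̄ = 1`. -/
theorem mem_traceSet_iff (a b t : ℚ) :
    t ∈ traceSet a b ↔ ∃ q : RatQuaternion a b,
      q * star q = 1 ∧ q + star q = algebraMap ℚ (RatQuaternion a b) t := by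
  constructor
  · rintro ⟨x₁, x₂, x₃, x₄, h, rfl⟩
    refine ⟨⟨x₁, x₂, x₃, x₄⟩, ?_, ?_⟩
    · ext <;> simp <;> linarith
    · ext <;> simp [QuaternionAlgebra.algebraMap_eq]
      ring
  · rintro ⟨q, h, ht⟩
    have h1 := congrArg QuaternionAlgebra.re h
    have h2 := congrArg QuaternionAlgebra.re ht
    simp [QuaternionAlgebra.algebraMap_eq] at h1 h2
    exact ⟨q.re, q.imI, q.imJ, q.imK, by linarith, by linarith⟩

/-- `T_{a,b} = S_{a,b} + S_{a,b}`, the set of all sums of two elements of `S_{a,b}`. -/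
def traceSumSet (a b : ℚ) : Set ℚ := traceSet a b + traceSet a b

/-- `ℤ_(p)`, the localization of `ℤ` at `p`, inside `ℚ`: the rationals whose reduced denominator
is not divisible by `p`. For the infinite place this is `ℤ_(∞) = [-4, 4] ∩ ℚ`. -/
def localIntegers : RatPlace → Set ℚ
  | .infinite => {x | -4 ≤ x ∧ x ≤ 4}
  | .finite p => {x | ¬ (p : ℕ) ∣ x.den}

/-! An element of norm 1 and trace s has pure part with square (s² - 4)/4. Thus s is such a trace
exactly when s² - 4 is represented by the form ⟨a, b, -ab⟩ of squares of pure quaternions.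

If s is a trace and s² - 4 is a nonzero square in K, the norm form becomes isotropic over K and K
splits the algebra (`splitsOver_of_mem_traceSet`). When |s|_p > 1, Hensel's lemma makes s² - 4 =
s²(1 - 4/s²) a square in ℚ_p; when |s| > 2 it is a square in ℝ. So at ramified places traces are
p-integral, respectively lie in [-2, 2], and sums of two traces obey the stated bounds.

The converse needs a local-global principle: c ≠ 0 is the square of a pure quaternion if it is a
nonsquare at every ramified place (`exists_pure_sq_eq_of_local`). One seeks n represented by ⟨a, -c⟩
with -n represented by ⟨b, -ab⟩, which are two conditions on Hilbert symbols. They are solvable at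
each place (`IsSymbol.exists_common_slot`); Dirichlet's theorem supplies a global n that is right
everywhere except possibly at one auxiliary prime q (`exists_approx_almost_unit`); the product
formula, i.e. quadratic reciprocity, takes care of q; and Legendre's descent
(`isNormFrom_rat_of_hilbertTrivial`) turns trivial symbols into rational solutions.

It remains to write t = s + s' with s² - 4 and s'² - 4 nonsquare at the ramified places. At p this
is a counting argument modulo p (`IsNonsplitTrace.exists_add`), at infinity one takes s close to
t/2, and approximation combines these choices (`exists_global_trace`). -/

/-- `b` is a norm from `K(√a)`; for nonzero `a, b` this says that `(a, b)` splits over `K`. -/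
def IsNormFrom {K : Type*} [Field K] (a b : K) : Prop := ∃ x y : K, x ^ 2 - a * y ^ 2 = b

/-! ### Norms from quadratic extensions and the pure quaternion form over a field -/

namespace IsNormFrom

variable {K : Type*} [Field K] {a b c : K}

theorem mul (hb : IsNormFrom a b) (hc : IsNormFrom a c) : IsNormFrom a (b * c) := by
  obtain ⟨x, y, rfl⟩ := hb
  obtain ⟨z, w, rfl⟩ := hc
  exact ⟨x * z + a * y * w, x * w + y * z, by ring⟩

theorem sq (a r : K) : IsNormFrom a (r ^ 2) := ⟨r, 0, by ring⟩

theorem neg_self (a : K) : IsNormFrom a (-a) := ⟨0, 1, by ring⟩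

theorem of_mul_sq {r : K} (hr : r ≠ 0) (h : IsNormFrom a (b * r ^ 2)) : IsNormFrom a b := by
  obtain ⟨x, y, h⟩ := h
  refine ⟨x / r, y / r, ?_⟩
  field_simp
  linear_combination h

theorem mul_sq_iff {r : K} (hr : r ≠ 0) : IsNormFrom a (b * r ^ 2) ↔ IsNormFrom a b :=
  ⟨of_mul_sq hr, fun h => h.mul (sq a r)⟩

theorem cancel_left (hb0 : b ≠ 0) (hb : IsNormFrom a b) (h : IsNormFrom a (b * c)) :
    IsNormFrom a c := by
  have := hb.mul h
  rw [show b * (b * c) = c * b ^ 2 by ring] at this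
  exact of_mul_sq hb0 this

theorem neg_mul_iff (ha : a ≠ 0) : IsNormFrom a (-(a * b)) ↔ IsNormFrom a b := by
  rw [← neg_mul]
  exact ⟨cancel_left (neg_ne_zero.2 ha) (neg_self a), fun h => (neg_self a).mul h⟩

theorem of_isSquare [NeZero (2 : K)] (ha : a ≠ 0) (h : IsSquare a) (b : K) : IsNormFrom a b := by
  obtain ⟨r, rfl⟩ := h
  have hr : r ≠ 0 := fun h => ha (by simp [h])
  have h2 : (2 : K) ≠ 0 := NeZero.ne 2
  refine ⟨(b + 1) / 2, (b - 1) / (2 * r), ?_⟩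
  field_simp
  ring

/-- Both sides express solvability of X² = aY² + bZ², which is symmetric in `a` and `b`. A solution
with `y = 0` cannot be divided by `y`, but then `b` is a square and every element is a norm. -/
theorem symm [NeZero (2 : K)] (hb : b ≠ 0) (h : IsNormFrom a b) :
    IsNormFrom b a := by
  obtain ⟨x, y, h⟩ := h
  by_cases hy : y = 0
  · subst hy
    exact of_isSquare hb ⟨x, by linear_combination -h⟩ a
  · refine ⟨x / y, 1 / y, ?_⟩
    field_simp
    linear_combination h

theorem comm [NeZero (2 : K)] (ha : a ≠ 0) (hb : b ≠ 0) : IsNormFrom a b ↔ IsNormFrom b a :=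
  ⟨symm hb, symm ha⟩

theorem sq_mul_left_iff [NeZero (2 : K)] {r : K} (hr : r ≠ 0) :
    IsNormFrom (a * r ^ 2) b ↔ IsNormFrom a b := by
  constructor
  · rintro ⟨x, y, h⟩
    exact ⟨x, r * y, by linear_combination h⟩
  · rintro ⟨x, y, h⟩
    exact ⟨x, y / r, by field_simp; linear_combination h⟩

/-- If the norm form of the quaternion algebra `(a, b)` is isotropic, then `b` is a norm from
`K(√a)`. -/
theorem of_isotropic [NeZero (2 : K)] (ha : a ≠ 0) {x y z w : K}
    (h : x ^ 2 - a * y ^ 2 - b * z ^ 2 + a * b * w ^ 2 = 0)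
    (hne : x ≠ 0 ∨ y ≠ 0 ∨ z ≠ 0 ∨ w ≠ 0) : IsNormFrom a b := by
  have sq_of : ∀ u v : K, u ^ 2 - a * v ^ 2 = 0 → u ≠ 0 ∨ v ≠ 0 → IsSquare a := by
    intro u v huv hne
    have hv : v ≠ 0 := by
      rintro rfl
      simp at huv
      simp [huv] at hne
    exact ⟨u / v, by field_simp; linear_combination -huv⟩
  by_cases h0 : z ^ 2 - a * w ^ 2 = 0
  · by_cases hzw : z ≠ 0 ∨ w ≠ 0
    · exact of_isSquare ha (sq_of z w h0 hzw) b
    · push Not at hzw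
      obtain ⟨rfl, rfl⟩ := hzw
      exact of_isSquare ha (sq_of x y (by linear_combination h) (by simpa using hne)) b
  · refine cancel_left h0 ⟨z, w, rfl⟩ ⟨x, y, by linear_combination h⟩

/-- If `(a, b)` splits, then its pure quaternions have arbitrary squares. -/
theorem universal [NeZero (2 : K)] (ha : a ≠ 0) (hb : b ≠ 0) (h : IsNormFrom a b) (c : K) :
    ∃ x y z : K, a * x ^ 2 + b * y ^ 2 - a * b * z ^ 2 = c := by
  obtain ⟨u, v, h⟩ := h
  have h2 : (2 : K) ≠ 0 := NeZero.ne 2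
  have hb' : u ^ 2 - a * v ^ 2 ≠ 0 := by rwa [h]
  -- As `b` is a norm, b⟨1, -a⟩ is isometric to ⟨1, -a⟩, so ⟨a, b, -ab⟩ contains the hyperbolic
  -- plane ⟨a, -a⟩. It then suffices to solve X² - Z² = c/a.
  set X : K := (c / a + 1) / 2
  set Z : K := (c / a - 1) / 2
  have hXZ : X ^ 2 - Z ^ 2 = c / a := by simp only [X, Z]; field_simp; ring
  refine ⟨X, -(a * v * Z) / (u ^ 2 - a * v ^ 2), u * Z / (u ^ 2 - a * v ^ 2), ?_⟩
  have hc : c = a * (X ^ 2 - Z ^ 2) := by rw [hXZ]; field_simp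
  rw [hc, ← h]
  field_simp
  ring

/-- The form `⟨a, b, -ab⟩` represents `c` as soon as `⟨a, -c⟩` and `⟨b, -ab⟩` represent `n` and
`-n` for a common nonzero `n`. -/
theorem exists_pure_sq_eq [NeZero (2 : K)] (ha : a ≠ 0) (hb : b ≠ 0) {n : K} (hn : n ≠ 0)
    (h₁ : IsNormFrom a (-(n * b))) (h₂ : IsNormFrom (a * c) (n * a)) :
    ∃ x y z : K, a * x ^ 2 + b * y ^ 2 - a * b * z ^ 2 = c := by
  obtain ⟨y, z, h₁⟩ := h₁
  obtain ⟨x, w, h₂⟩ := h₂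
  by_cases hw : w = 0
  · subst hw
    have hx : x ≠ 0 := by
      rintro rfl
      have : n * a = 0 := by linear_combination -h₂
      simp_all
    refine universal ha hb ?_ c
    have hx2 : x ^ 2 = n * a := by linear_combination h₂
    refine (neg_mul_iff ha).1 (of_mul_sq (r := x / a) (div_ne_zero hx ha) ?_)
    have : -(a * b) * (x / a) ^ 2 = -(n * b) := by
      rw [div_pow, hx2]
      field_simp
    exact this ▸ ⟨y, z, h₁⟩
  · refine ⟨x / (a * w), y / (b * w), z / (b * w), ?_⟩
    field_simp
    linear_combination b * h₂ + a * h₁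

end IsNormFrom

/-! ### Splitting of the algebra as a norm condition -/

section Splitting

variable (K : Type) [Field K] [Algebra ℚ K]

/-- The algebra of `2 × 2` matrices contains a standard quaternion basis for `(a, b)` whenever `b`
is a norm from `K(√a)`. -/
def matrixQuaternionBasis {K : Type} [Field K] (a b x y : K) (h : x ^ 2 - a * y ^ 2 = b) :
    QuaternionAlgebra.Basis (Matrix (Fin 2) (Fin 2) K) a 0 b where
  -- In the basis 1, √a of K[√a], `i` is multiplication by √a and `j` is conjugation followed by
  -- multiplication by x + y√a.
  i := !![0, a; 1, 0]
  j := !![x, -(a * y); y, -x]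
  k := !![a * y, -(a * x); x, -(a * y)]
  i_mul_i := by
    ext i j; fin_cases i <;> fin_cases j <;> simp [Matrix.mul_apply, Fin.sum_univ_two]
  j_mul_j := by
    subst h
    ext i j
    fin_cases i <;> fin_cases j <;> simp [Matrix.mul_apply, Fin.sum_univ_two] <;> ring
  i_mul_j := by
    ext i j; fin_cases i <;> fin_cases j <;> simp [Matrix.mul_apply, Fin.sum_univ_two]
  j_mul_i := by
    ext i j; fin_cases i <;> fin_cases j <;> simp [Matrix.mul_apply, Fin.sum_univ_two] <;> ring

variable {K}

omit [Algebra ℚ K] in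
theorem bijective_lift_matrixQuaternionBasis [NeZero (2 : K)] {a b x y : K} (ha : a ≠ 0) (hb : b ≠ 0)
    (h : x ^ 2 - a * y ^ 2 = b) :
    Function.Bijective (matrixQuaternionBasis a b x y h).liftHom := by
  have h2 : (2 : K) ≠ 0 := NeZero.ne 2
  have inj : Function.Injective (matrixQuaternionBasis a b x y h).liftHom := by
    rw [injective_iff_map_eq_zero]
    rintro ⟨p, q, r, s⟩ hq
    have e := fun i j => congrFun (congrFun hq i) j
    have e00 := e 0 0
    have e01 := e 0 1
    have e10 := e 1 0
    have e11 := e 1 1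
    simp [QuaternionAlgebra.Basis.liftHom, QuaternionAlgebra.Basis.lift, matrixQuaternionBasis,
      Matrix.algebraMap_matrix_apply] at e00 e01 e10 e11
    have hp : p = 0 := by
      have : 2 * p = 0 := by linear_combination e00 + e11
      simpa [h2] using this
    subst hp
    have e01' : q - r * y - s * x = 0 := by
      have : a * (q - r * y - s * x) = 0 := by linear_combination e01
      simpa [ha] using this
    have hq0 : q = 0 := by
      have : 2 * q = 0 := by linear_combination e01' + e10
      simpa [h2] using this
    subst hq0
    have h1 : x * r + a * y * s = 0 := by linear_combination e00
    have h3 : y * r + x * s = 0 := by linear_combination e10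
    have hr : r = 0 := by
      have : b * r = 0 := by rw [← h]; linear_combination x * h1 - a * y * h3
      simpa [hb] using this
    have hs : s = 0 := by
      have : b * s = 0 := by rw [← h]; linear_combination x * h3 - y * h1
      simpa [hb] using this
    subst hr hs
    rfl
  have fr : Module.finrank K ℍ[K, a, b] = Module.finrank K (Matrix (Fin 2) (Fin 2) K) := by
    rw [QuaternionAlgebra.finrank_eq_four, Module.finrank_matrix]
    simp
  exact ⟨inj, (LinearMap.injective_iff_surjective_of_finrank_eq_finrank
    (f := (matrixQuaternionBasis a b x y h).liftHom.toLinearMap) fr).1 inj⟩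

theorem ratCast_smul_one_tensor (a b c : ℚ) :
    (c • 1 : K ⊗[ℚ] RatQuaternion a b) = (c : K) • 1 := by
  rw [← eq_ratCast (algebraMap ℚ K) c, algebraMap_smul]

variable (K) in
/-- The standard quaternion basis of the base change of `(a, b)`. -/
def baseChangeQuaternionBasis (a b : ℚ) :
    QuaternionAlgebra.Basis (K ⊗[ℚ] RatQuaternion a b) (a : K) 0 (b : K) where
  i := 1 ⊗ₜ ⟨0, 1, 0, 0⟩
  j := 1 ⊗ₜ ⟨0, 0, 1, 0⟩
  k := 1 ⊗ₜ ⟨0, 0, 0, 1⟩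
  i_mul_i := by
    have : (⟨0, 1, 0, 0⟩ * ⟨0, 1, 0, 0⟩ : RatQuaternion a b) = a • 1 := by ext <;> simp
    rw [Algebra.TensorProduct.tmul_mul_tmul, this, TensorProduct.tmul_smul, mul_one, zero_smul,
      add_zero, ← Algebra.TensorProduct.one_def, ratCast_smul_one_tensor]
  j_mul_j := by
    have : (⟨0, 0, 1, 0⟩ * ⟨0, 0, 1, 0⟩ : RatQuaternion a b) = b • 1 := by ext <;> simp
    rw [Algebra.TensorProduct.tmul_mul_tmul, this, TensorProduct.tmul_smul, mul_one,
      ← Algebra.TensorProduct.one_def, ratCast_smul_one_tensor]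
  i_mul_j := by
    simp
  j_mul_i := by
    have : (⟨0, 0, 1, 0⟩ * ⟨0, 1, 0, 0⟩ : RatQuaternion a b) = -⟨0, 0, 0, 1⟩ := by ext <;> simp
    rw [Algebra.TensorProduct.tmul_mul_tmul, this, TensorProduct.tmul_neg, mul_one, zero_smul,
      zero_sub]

variable (K) in
theorem bijective_lift_baseChangeQuaternionBasis (a b : ℚ) :
    Function.Bijective (baseChangeQuaternionBasis K a b).liftHom := by
  have surj : Function.Surjective (baseChangeQuaternionBasis K a b).liftHom := by
    intro t
    induction t using TensorProduct.induction_on with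
    | zero => exact ⟨0, map_zero _⟩
    | add u v hu hv =>
      obtain ⟨u, rfl⟩ := hu
      obtain ⟨v, rfl⟩ := hv
      exact ⟨u + v, map_add _ _ _⟩
    | tmul k q =>
      refine ⟨⟨k * q.re, k * q.imI, k * q.imJ, k * q.imK⟩, ?_⟩
      have hq : q = q.re • 1 + q.imI • ⟨0, 1, 0, 0⟩ + q.imJ • ⟨0, 0, 1, 0⟩ +
        q.imK • ⟨0, 0, 0, 1⟩ := by ext <;> simp
      conv_rhs => rw [hq]
      have cast (r : ℚ) (v : RatQuaternion a b) : k ⊗ₜ[ℚ] (r • v) = (k * r) • (1 : K) ⊗ₜ[ℚ] v := by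
        rw [TensorProduct.smul_tmul', TensorProduct.tmul_smul, TensorProduct.smul_tmul',
          smul_eq_mul, mul_one, Algebra.smul_def, eq_ratCast, mul_comm]
      rw [TensorProduct.tmul_add, TensorProduct.tmul_add, TensorProduct.tmul_add, cast, cast, cast,
        cast]
      simp [QuaternionAlgebra.Basis.liftHom, QuaternionAlgebra.Basis.lift,
        baseChangeQuaternionBasis, Algebra.algebraMap_eq_smul_one, Algebra.TensorProduct.one_def]
  have fr : Module.finrank K ℍ[K, (a : K), (b : K)] =
      Module.finrank K (K ⊗[ℚ] RatQuaternion a b) := by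
    rw [QuaternionAlgebra.finrank_eq_four, Module.finrank_baseChange,
      QuaternionAlgebra.finrank_eq_four]
  exact ⟨(LinearMap.injective_iff_surjective_of_finrank_eq_finrank
    (f := (baseChangeQuaternionBasis K a b).liftHom.toLinearMap) fr).2 surj, surj⟩

theorem splitsOver_of_isNormFrom (a b : ℚ) (ha : a ≠ 0) (hb : b ≠ 0)
    (h : IsNormFrom (a : K) (b : K)) : SplitsOver a b K := by
  have : CharZero K := algebraRat.charZero K
  obtain ⟨x, y, h⟩ := h
  exact ⟨(AlgEquiv.ofBijective _ (bijective_lift_baseChangeQuaternionBasis K a b)).symm.trans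
    (AlgEquiv.ofBijective _ (bijective_lift_matrixQuaternionBasis (by exact_mod_cast ha)
      (by exact_mod_cast hb) h))⟩

/-- A nonzero nilpotent matrix pulls back to a nonzero quaternion `q` with q² = 0. Its norm
annihilates `q`, so the norm form is isotropic. -/
theorem isNormFrom_of_splitsOver (a b : ℚ) (ha : a ≠ 0)
    (h : SplitsOver a b K) : IsNormFrom (a : K) (b : K) := by
  have : CharZero K := algebraRat.charZero K
  obtain ⟨e⟩ := h
  let f : ℍ[K, (a : K), (b : K)] ≃ₐ[K] Matrix (Fin 2) (Fin 2) K :=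
    (AlgEquiv.ofBijective _ (bijective_lift_baseChangeQuaternionBasis K a b)).trans e
  set q := f.symm !![0, 1; 0, 0] with hq
  have hq0 : q ≠ 0 := by
    rw [hq, Ne, EmbeddingLike.map_eq_zero_iff]
    intro h
    simpa using congrFun (congrFun h 0) 1
  have hqq : q * q = 0 := by
    rw [hq, ← map_mul, EmbeddingLike.map_eq_zero_iff]
    ext i j
    fin_cases i <;> fin_cases j <;> simp
  have hN : q * star q = algebraMap K _
      (q.re ^ 2 - a * q.imI ^ 2 - b * q.imJ ^ 2 + a * b * q.imK ^ 2) := by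
    ext <;> simp [QuaternionAlgebra.algebraMap_eq] <;> ring
  have h0 : (q.re ^ 2 - a * q.imI ^ 2 - b * q.imJ ^ 2 + a * b * q.imK ^ 2) • q = 0 := by
    rw [Algebra.smul_def, Algebra.commutes, ← hN, ← mul_assoc, hqq, zero_mul]
  refine IsNormFrom.of_isotropic (by exact_mod_cast ha) ((smul_eq_zero.1 h0).resolve_right hq0) ?_
  by_contra! h
  exact hq0 (by ext <;> simp [h])

theorem splitsOver_iff_isNormFrom (a b : ℚ) (ha : a ≠ 0) (hb : b ≠ 0) :
    SplitsOver a b K ↔ IsNormFrom (a : K) (b : K) :=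
  ⟨isNormFrom_of_splitsOver a b ha, splitsOver_of_isNormFrom a b ha hb⟩

end Splitting

/-! ### Explicit Hilbert symbols: bilinearity and local constancy -/

section HilbertSymbol

open ZMod
open scoped NumberTheorySymbols

/-- The part of an integer that is prime to `p`. -/
def primeToPart (p : ℕ) (a : ℤ) : ℤ := a / (p : ℤ) ^ padicValInt p a

theorem pow_mul_primeToPart (p : ℕ) (a : ℤ) :
    (p : ℤ) ^ padicValInt p a * primeToPart p a = a :=
  Int.mul_ediv_cancel' (padicValInt_dvd a)

variable {p : ℕ} [hp : Fact p.Prime]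

theorem not_dvd_primeToPart {a : ℤ} (ha : a ≠ 0) : ¬ (p : ℤ) ∣ primeToPart p a := by
  rintro ⟨c, hc⟩
  have h : (p : ℤ) ^ (padicValInt p a + 1) ∣ a :=
    ⟨c, by conv_lhs => rw [← pow_mul_primeToPart p a, hc]
           ring⟩
  rw [padicValInt_dvd_iff] at h
  have := h.resolve_left ha
  omega

theorem padicValInt_pow_mul {u : ℤ} (hu : ¬ (p : ℤ) ∣ u) (k : ℕ) :
    padicValInt p ((p : ℤ) ^ k * u) = k := by
  have hu0 : u ≠ 0 := by rintro rfl; simp at hu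
  have hp0 : (p : ℤ) ≠ 0 := by exact_mod_cast hp.out.ne_zero
  induction k with
  | zero => simpa using padicValInt.eq_zero_of_not_dvd hu
  | succ k ih =>
    rw [pow_succ', mul_assoc, padicValInt.mul hp0 (mul_ne_zero (pow_ne_zero _ hp0) hu0), ih,
      padicValInt_self, add_comm]

theorem primeToPart_pow_mul {u : ℤ} (hu : ¬ (p : ℤ) ∣ u) (k : ℕ) :
    primeToPart p ((p : ℤ) ^ k * u) = u := by
  have hp0 : (p : ℤ) ≠ 0 := by exact_mod_cast hp.out.ne_zero
  rw [primeToPart, padicValInt_pow_mul hu, Int.mul_ediv_cancel_left _ (pow_ne_zero _ hp0)]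

theorem not_dvd_mul {u v : ℤ} (hu : ¬ (p : ℤ) ∣ u) (hv : ¬ (p : ℤ) ∣ v) : ¬ (p : ℤ) ∣ u * v :=
  fun h => ((Nat.prime_iff_prime_int.1 hp.out).dvd_or_dvd h).elim hu hv

theorem primeToPart_mul {a b : ℤ} (ha : a ≠ 0) (hb : b ≠ 0) :
    primeToPart p (a * b) = primeToPart p a * primeToPart p b := by
  conv_lhs => rw [← pow_mul_primeToPart p a, ← pow_mul_primeToPart p b, mul_mul_mul_comm, ← pow_add]
  exact primeToPart_pow_mul (not_dvd_mul (not_dvd_primeToPart ha) (not_dvd_primeToPart hb)) _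

/-- Every nonzero integer is a power of `p` times an integer prime to `p`. -/
theorem exists_eq_pow_mul_not_dvd (p : ℕ) [Fact p.Prime] {a : ℤ} (ha : a ≠ 0) :
    ∃ (k : ℕ) (u : ℤ), ¬ (p : ℤ) ∣ u ∧ a = (p : ℤ) ^ k * u :=
  ⟨_, _, not_dvd_primeToPart ha, (pow_mul_primeToPart p a).symm⟩

omit hp in
/-- The Hilbert symbol at a prime `p` of two nonzero integers. -/
def hilbertSymbol (p : ℕ) (a b : ℤ) : ℤ :=
  if p = 2 then
    -- For odd parts u and v the first factor is (-1)^((u-1)/2 · (v-1)/2).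
    (if χ₄ (primeToPart 2 a) = -1 then χ₄ (primeToPart 2 b) else 1) *
      χ₈ (primeToPart 2 a) ^ padicValInt 2 b * χ₈ (primeToPart 2 b) ^ padicValInt 2 a
  else
    J(-1 | p) ^ (padicValInt p a * padicValInt p b) * J(primeToPart p a | p) ^ padicValInt p b *
      J(primeToPart p b | p) ^ padicValInt p a

omit hp in
/-- The Hilbert symbol at the infinite place of two nonzero integers. -/
def hilbertSymbolInf (a b : ℤ) : ℤ := if a < 0 ∧ b < 0 then -1 else 1

theorem χ₄_eq_one_or {u : ℤ} (hu : ¬ (2 : ℤ) ∣ u) : χ₄ u = 1 ∨ χ₄ u = -1 := by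
  rw [χ₄_int_eq_if_mod_four]
  have : u % 2 ≠ 0 := by omega
  simp only [this, if_false]
  split_ifs <;> simp

theorem χ₈_eq_one_or {u : ℤ} (hu : ¬ (2 : ℤ) ∣ u) : χ₈ u = 1 ∨ χ₈ u = -1 := by
  rw [χ₈_int_eq_if_mod_eight]
  have : u % 2 ≠ 0 := by omega
  simp only [this, if_false]
  split_ifs <;> simp

theorem gcd_eq_one_of_not_dvd {u : ℤ} (hu : ¬ (p : ℤ) ∣ u) : u.gcd p = 1 := by
  rw [Int.gcd_comm, Int.gcd_eq_natAbs, Int.natAbs_natCast]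
  exact (Nat.Prime.coprime_iff_not_dvd hp.out).2 (by rwa [← Int.natCast_dvd])

theorem jacobiSym_eq_one_or {u : ℤ} (hu : ¬ (p : ℤ) ∣ u) : J(u | p) = 1 ∨ J(u | p) = -1 :=
  jacobiSym.eq_one_or_neg_one (gcd_eq_one_of_not_dvd hu)

theorem hilbertSymbol_comm {a b : ℤ} (ha : a ≠ 0) (hb : b ≠ 0) :
    hilbertSymbol p a b = hilbertSymbol p b a := by
  unfold hilbertSymbol
  split_ifs with h2 h3 h4 h4
  · subst h2
    rw [h3, h4]; ring
  · subst h2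
    have := (χ₄_eq_one_or (not_dvd_primeToPart (p := 2) hb)).resolve_right h4
    rw [this]; ring
  · subst h2
    have := (χ₄_eq_one_or (not_dvd_primeToPart (p := 2) ha)).resolve_right h3
    rw [this]; ring
  · ring
  · rw [mul_comm (padicValInt p a) (padicValInt p b)]; ring

theorem hilbertSymbol_mul_left {a a' b : ℤ} (ha : a ≠ 0) (ha' : a' ≠ 0) (hb : b ≠ 0) :
    hilbertSymbol p (a * a') b = hilbertSymbol p a b * hilbertSymbol p a' b := by
  unfold hilbertSymbol
  by_cases h2 : p = 2
  · subst h2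
    simp only [if_true]
    rw [primeToPart_mul ha ha', padicValInt.mul ha ha']
    push_cast
    rw [map_mul, map_mul, pow_add, mul_pow]
    rcases χ₄_eq_one_or (not_dvd_primeToPart (p := 2) ha) with h | h <;>
    rcases χ₄_eq_one_or (not_dvd_primeToPart (p := 2) ha') with h' | h' <;>
    rcases χ₄_eq_one_or (not_dvd_primeToPart (p := 2) hb) with h'' | h'' <;>
    simp [h, h', h''] <;> ring
  · simp only [h2, if_false]
    rw [primeToPart_mul ha ha', padicValInt.mul ha ha', jacobiSym.mul_left]
    ring

theorem hilbertSymbol_mul_right {a b b' : ℤ} (ha : a ≠ 0) (hb : b ≠ 0) (hb' : b' ≠ 0) :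
    hilbertSymbol p a (b * b') = hilbertSymbol p a b * hilbertSymbol p a b' := by
  rw [hilbertSymbol_comm ha (mul_ne_zero hb hb'), hilbertSymbol_mul_left hb hb' ha,
    hilbertSymbol_comm hb ha, hilbertSymbol_comm hb' ha]

theorem eq_one_or_mul {x y : ℤ} (hx : x = 1 ∨ x = -1) (hy : y = 1 ∨ y = -1) :
    x * y = 1 ∨ x * y = -1 := by
  rcases hx with rfl | rfl <;> rcases hy with rfl | rfl <;> simp

theorem eq_one_or_pow {x : ℤ} (hx : x = 1 ∨ x = -1) (n : ℕ) : x ^ n = 1 ∨ x ^ n = -1 := by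
  rcases hx with rfl | rfl
  · simp
  · exact neg_one_pow_eq_or ℤ n

theorem not_dvd_neg_one : ¬ (p : ℤ) ∣ -1 := by
  rw [Int.dvd_neg, Int.natCast_dvd]
  simpa using hp.out.one_lt.ne'

theorem hilbertSymbol_eq_one_or {a b : ℤ} (ha : a ≠ 0) (hb : b ≠ 0) :
    hilbertSymbol p a b = 1 ∨ hilbertSymbol p a b = -1 := by
  unfold hilbertSymbol
  have hua := not_dvd_primeToPart (p := p) ha
  have hub := not_dvd_primeToPart (p := p) hb
  by_cases h2 : p = 2
  · subst h2
    simp only [if_true]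
    refine eq_one_or_mul (eq_one_or_mul ?_ (eq_one_or_pow (χ₈_eq_one_or hua) _))
      (eq_one_or_pow (χ₈_eq_one_or hub) _)
    split_ifs
    · exact χ₄_eq_one_or hub
    · simp
  · simp only [h2, if_false]
    exact eq_one_or_mul (eq_one_or_mul (eq_one_or_pow (jacobiSym_eq_one_or not_dvd_neg_one) _)
      (eq_one_or_pow (jacobiSym_eq_one_or hua) _)) (eq_one_or_pow (jacobiSym_eq_one_or hub) _)

theorem hilbertSymbol_mul_self {a b : ℤ} (ha : a ≠ 0) (hb : b ≠ 0) :
    hilbertSymbol p a b * hilbertSymbol p a b = 1 := by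
  rcases hilbertSymbol_eq_one_or (p := p) ha hb with h | h <;> simp [h]

theorem hilbertSymbol_mul_sq_left {a b r : ℤ} (ha : a ≠ 0) (hb : b ≠ 0) (hr : r ≠ 0) :
    hilbertSymbol p (a * r ^ 2) b = hilbertSymbol p a b := by
  rw [hilbertSymbol_mul_left ha (pow_ne_zero _ hr) hb, sq, hilbertSymbol_mul_left hr hr hb,
    hilbertSymbol_mul_self hr hb, mul_one]

omit hp in
theorem hilbertSymbol_of_not_dvd (h2 : p ≠ 2) {u v : ℤ} (hu : ¬ (p : ℤ) ∣ u)
    (hv : ¬ (p : ℤ) ∣ v) : hilbertSymbol p u v = 1 := by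
  simp [hilbertSymbol, h2, padicValInt.eq_zero_of_not_dvd hu, padicValInt.eq_zero_of_not_dvd hv]

theorem hilbertSymbol_pow_mul (h2 : p ≠ 2) {u v : ℤ} (hu : ¬ (p : ℤ) ∣ u)
    (hv : ¬ (p : ℤ) ∣ v) (k l : ℕ) : hilbertSymbol p ((p : ℤ) ^ k * u) ((p : ℤ) ^ l * v) =
      J(-1 | p) ^ (k * l) * J(u | p) ^ l * J(v | p) ^ k := by
  simp [hilbertSymbol, h2, padicValInt_pow_mul hu, padicValInt_pow_mul hv, primeToPart_pow_mul hu,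
    primeToPart_pow_mul hv]

theorem hilbertSymbol_two_pow_mul {u v : ℤ} (hu : ¬ (2 : ℤ) ∣ u)
    (hv : ¬ (2 : ℤ) ∣ v) (k l : ℕ) : hilbertSymbol 2 (2 ^ k * u) (2 ^ l * v) =
      (if χ₄ u = -1 then χ₄ v else 1) * χ₈ u ^ l * χ₈ v ^ k := by
  have h1 := padicValInt_pow_mul (p := 2) hu k
  have h2 := padicValInt_pow_mul (p := 2) hv l
  have h3 := primeToPart_pow_mul (p := 2) hu k
  have h4 := primeToPart_pow_mul (p := 2) hv l
  rw [Nat.cast_ofNat] at h1 h2 h3 h4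
  simp [hilbertSymbol, h1, h2, h3, h4]

/-- The Hilbert symbol is locally constant. -/
theorem hilbertSymbol_congr {m n : ℤ} (b : ℤ) (hm : m ≠ 0)
    (h : n ≡ m [ZMOD (p : ℤ) ^ (padicValInt p m + 3)]) :
    n ≠ 0 ∧ hilbertSymbol p n b = hilbertSymbol p m b := by
  have hp0 : (p : ℤ) ≠ 0 := by exact_mod_cast hp.out.ne_zero
  obtain ⟨k, u, hu, rfl⟩ := exists_eq_pow_mul_not_dvd p hm
  rw [padicValInt_pow_mul hu] at h
  obtain ⟨c, hc⟩ := h.symm.dvd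
  -- The unit parts agree modulo p³. The exponent 3 is what `χ₈` requires at p = 2; for odd p
  -- agreement modulo p would do.
  obtain ⟨v, rfl⟩ : ∃ v, v = u + p ^ 3 * c := ⟨_, rfl⟩
  have hn : n = (p : ℤ) ^ k * (u + p ^ 3 * c) := by linear_combination hc
  have hv : ¬ (p : ℤ) ∣ (u + p ^ 3 * c) := fun hd =>
    hu ((Int.dvd_add_left (Dvd.dvd.mul_right (dvd_pow_self _ (by norm_num)) _)).1 hd)
  subst hn
  refine ⟨mul_ne_zero (pow_ne_zero _ hp0) (by intro h0; simp [h0] at hv), ?_⟩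
  unfold hilbertSymbol
  by_cases h2 : p = 2
  · subst h2
    simp only [if_true, padicValInt_pow_mul hu, padicValInt_pow_mul hv, primeToPart_pow_mul hu,
      primeToPart_pow_mul hv]
    rw [χ₄_int_mod_four, χ₈_int_mod_eight, χ₄_int_mod_four u, χ₈_int_mod_eight u]
    have h8 : (u + (2 : ℕ) ^ 3 * c) % 8 = u % 8 := by push_cast; omega
    have h4 : (u + (2 : ℕ) ^ 3 * c) % 4 = u % 4 := by push_cast; omega
    rw [h8, h4]
  · simp only [h2, if_false, padicValInt_pow_mul hu, padicValInt_pow_mul hv,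
      primeToPart_pow_mul hu, primeToPart_pow_mul hv]
    have : J(u + p ^ 3 * c | p) = J(u | p) := by
      apply jacobiSym.mod_left'
      rw [pow_succ', mul_assoc, Int.add_mul_emod_self_left]
    rw [this]

end HilbertSymbol

/-! ### The product formula from quadratic reciprocity -/

section ProductFormula

open ZMod
open scoped NumberTheorySymbols

theorem hilbertSymbolInf_comm (a b : ℤ) : hilbertSymbolInf a b = hilbertSymbolInf b a := by
  simp [hilbertSymbolInf, and_comm]

theorem hilbertSymbolInf_mul_left {a a' : ℤ} (b : ℤ) (ha : a ≠ 0) (ha' : a' ≠ 0) :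
    hilbertSymbolInf (a * a') b = hilbertSymbolInf a b * hilbertSymbolInf a' b := by
  unfold hilbertSymbolInf
  rcases ha.lt_or_gt with h | h <;> rcases ha'.lt_or_gt with h' | h' <;>
  by_cases hb : b < 0 <;>
  simp [hb, mul_neg_iff, h, h', h.not_gt, h'.not_gt]

theorem hilbertSymbolInf_natCast (a : ℤ) (n : ℕ) : hilbertSymbolInf a n = 1 := by
  simp [hilbertSymbolInf]

theorem hilbertSymbolInf_eq_one_or (a b : ℤ) :
    hilbertSymbolInf a b = 1 ∨ hilbertSymbolInf a b = -1 := by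
  unfold hilbertSymbolInf
  split_ifs <;> simp

/-- The product formula for the pair `(a, b)`. -/
def ProductFormula (a b : ℤ) : Prop :=
  ∀ N : ℕ, N ≠ 0 → 2 ∣ N → a ∣ N → b ∣ N →
    hilbertSymbolInf a b * ∏ p ∈ N.primeFactors, hilbertSymbol p a b = 1

namespace ProductFormula

theorem symm {a b : ℤ} (ha : a ≠ 0) (hb : b ≠ 0) (h : ProductFormula a b) :
    ProductFormula b a := by
  intro N h0 h2 hbN haN
  rw [← h N h0 h2 haN hbN, hilbertSymbolInf_comm]
  congr 1
  refine Finset.prod_congr rfl fun p hp => ?_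
  have : Fact p.Prime := ⟨Nat.prime_of_mem_primeFactors hp⟩
  exact hilbertSymbol_comm hb ha

theorem mul_left {a a' b : ℤ} (ha : a ≠ 0) (ha' : a' ≠ 0) (hb : b ≠ 0) (h : ProductFormula a b)
    (h' : ProductFormula a' b) : ProductFormula (a * a') b := by
  intro N h0 h2 haN hbN
  have e := h N h0 h2 (dvd_of_mul_right_dvd haN) hbN
  have e' := h' N h0 h2 (dvd_of_mul_left_dvd haN) hbN
  rw [hilbertSymbolInf_mul_left b ha ha', Finset.prod_congr rfl (g := fun p =>
    hilbertSymbol p a b * hilbertSymbol p a' b), Finset.prod_mul_distrib]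
  · linear_combination
      (hilbertSymbolInf a' b * ∏ p ∈ N.primeFactors, hilbertSymbol p a' b) * e + e'
  · intro p hp
    have : Fact p.Prime := ⟨Nat.prime_of_mem_primeFactors hp⟩
    exact hilbertSymbol_mul_left ha ha' hb

/-- A multiplicative property of nonzero integers holds as soon as it holds for `-1` and for all
primes. -/
theorem _root_.Int.induction_on_neg_one_primes {P : ℤ → Prop} (neg_one : P (-1))
    (prime : ∀ p : ℕ, p.Prime → P p) (mul : ∀ a b : ℤ, a ≠ 0 → b ≠ 0 → P a → P b → P (a * b))
    {a : ℤ} (ha : a ≠ 0) : P a := by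
  have one : P 1 := by simpa using mul (-1) (-1) (by simp) (by simp) neg_one neg_one
  have nat : ∀ n : ℕ, n ≠ 0 → P n := by
    intro n
    induction n using induction_on_primes with
    | zero => simp
    | one => simpa using one
    | prime_mul p n hp ih =>
      intro h
      have hn : n ≠ 0 := right_ne_zero_of_mul h
      push_cast
      exact mul _ _ (by exact_mod_cast hp.ne_zero) (by exact_mod_cast hn) (prime p hp) (ih hn)
  rcases Int.natAbs_eq a with h | h
  · rw [h]; exact nat _ (Int.natAbs_ne_zero.2 ha)
  · rw [h, neg_eq_neg_one_mul]
    exact mul _ _ (by simp) (by simpa using ha) neg_one (nat _ (Int.natAbs_ne_zero.2 ha))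

/-- Primes not dividing `2ab` may be disregarded in the product formula. -/
theorem of_subset {a b : ℤ} (s : Finset ℕ)
    (hs : ∀ p, p.Prime → p ∉ s → p ≠ 2 ∧ ¬ (p : ℤ) ∣ a ∧ ¬ (p : ℤ) ∣ b)
    (hs' : ∀ p ∈ s, p.Prime ∧ (p = 2 ∨ (p : ℤ) ∣ a ∨ (p : ℤ) ∣ b))
    (h : hilbertSymbolInf a b * ∏ p ∈ s, hilbertSymbol p a b = 1) : ProductFormula a b := by
  intro N h0 h2 haN hbN
  rw [← h]
  congr 1
  symm
  apply Finset.prod_subset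
  · intro p hp
    obtain ⟨hpp, hd⟩ := hs' p hp
    refine Nat.mem_primeFactors.2 ⟨hpp, ?_, h0⟩
    rcases hd with rfl | hd | hd
    · exact h2
    · exact_mod_cast hd.trans haN
    · exact_mod_cast hd.trans hbN
  · intro p hp hps
    have hpp := Nat.prime_of_mem_primeFactors hp
    have : Fact p.Prime := ⟨hpp⟩
    obtain ⟨h1, h2, h3⟩ := hs p hpp hps
    exact hilbertSymbol_of_not_dvd h1 h2 h3

theorem not_dvd_natCast {p q : ℕ} (hp : p.Prime) (hq : q.Prime) (h : p ≠ q) : ¬ (p : ℤ) ∣ q := by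
  rw [Int.natCast_dvd_natCast, Nat.prime_dvd_prime_iff_eq hp hq]
  exact h

theorem neg_one_neg_one : ProductFormula (-1) (-1) := by
  refine of_subset {2} (fun p hp h => ?_) (by simp [Nat.prime_two]) ?_
  · have : Fact p.Prime := ⟨hp⟩
    exact ⟨by simpa using h, not_dvd_neg_one, not_dvd_neg_one⟩
  · have := hilbertSymbol_two_pow_mul (u := -1) (v := -1) (by decide) (by decide) 0 0
    have h4 : χ₄ ((-1 : ℤ) : ZMod 4) = -1 := by decide
    simp only [pow_zero, one_mul, mul_one, h4, if_true] at this
    simp [this, hilbertSymbolInf]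

theorem two_left {b : ℤ} (hb : b = -1 ∨ b = 2) : ProductFormula 2 b := by
  refine of_subset {2} (fun p hp h => ?_) (by simp [Nat.prime_two]) ?_
  · have : Fact p.Prime := ⟨hp⟩
    have h2 : p ≠ 2 := by simpa using h
    have := not_dvd_natCast hp Nat.prime_two h2
    refine ⟨h2, this, ?_⟩
    rcases hb with rfl | rfl
    · exact not_dvd_neg_one
    · exact this
  · rcases hb with rfl | rfl
    · have := hilbertSymbol_two_pow_mul (u := 1) (v := -1) (by decide) (by decide) 1 0
      have h4 : χ₄ ((1 : ℤ) : ZMod 4) ≠ -1 := by decide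
      have h8 : χ₈ ((-1 : ℤ) : ZMod 8) = 1 := by decide
      simp only [pow_zero, pow_one, one_mul, mul_one, h4, if_false, h8] at this
      simp [this, hilbertSymbolInf]
    · have := hilbertSymbol_two_pow_mul (u := 1) (v := 1) (by decide) (by decide) 1 1
      have h4 : χ₄ ((1 : ℤ) : ZMod 4) ≠ -1 := by decide
      have h8 : χ₈ ((1 : ℤ) : ZMod 8) = 1 := by decide
      simp only [pow_one, mul_one, h4, if_false, h8] at this
      simp [this, hilbertSymbolInf]

variable {q : ℕ} (hq : q.Prime) (hq2 : q ≠ 2)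
include hq hq2

theorem not_two_dvd : ¬ (2 : ℤ) ∣ q := not_dvd_natCast Nat.prime_two hq hq2.symm

/-- This is the first supplement to quadratic reciprocity: only the symbols at 2 and `q` can be
nontrivial. -/
theorem neg_one_prime : ProductFormula (-1) q := by
  have := Fact.mk hq
  refine of_subset {2, q} (fun p hp h => ?_) (by simp [Nat.prime_two, hq]) ?_
  · have : Fact p.Prime := ⟨hp⟩
    simp at h
    exact ⟨h.1, not_dvd_neg_one, not_dvd_natCast hp hq h.2⟩
  · have h2 := hilbertSymbol_two_pow_mul (u := -1) (v := q) (by decide) (not_two_dvd hq hq2) 0 0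
    have h3 := hilbertSymbol_pow_mul (p := q) hq2 (u := -1) (v := 1) not_dvd_neg_one
      (by simpa using not_dvd_neg_one (p := q)) 0 1
    have h4 : χ₄ ((-1 : ℤ) : ZMod 4) = -1 := by decide
    simp only [pow_zero, pow_one, one_mul, mul_one, h4, if_true] at h2 h3
    rw [Finset.prod_pair hq2.symm, h2, h3]
    have hodd : Odd q := hq.odd_of_ne_two hq2
    rw [hilbertSymbolInf_natCast, jacobiSym.at_neg_one hodd]
    rcases χ₄_eq_one_or (not_two_dvd hq hq2) with h | h <;> rw [Int.cast_natCast] at h <;> simp [h]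

/-- This is the second supplement to quadratic reciprocity. -/
theorem two_prime : ProductFormula 2 q := by
  have := Fact.mk hq
  refine of_subset {2, q} (fun p hp h => ?_) (by simp [Nat.prime_two, hq]) ?_
  · have : Fact p.Prime := ⟨hp⟩
    simp at h
    exact ⟨h.1, not_dvd_natCast hp Nat.prime_two h.1, not_dvd_natCast hp hq h.2⟩
  · have h2 := hilbertSymbol_two_pow_mul (u := 1) (v := q) (by decide) (not_two_dvd hq hq2) 1 0
    have h3 := hilbertSymbol_pow_mul (p := q) hq2 (u := 2) (v := 1)
      (not_dvd_natCast hq Nat.prime_two hq2) (by simpa using not_dvd_neg_one (p := q)) 0 1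
    have h4 : χ₄ ((1 : ℤ) : ZMod 4) ≠ -1 := by decide
    simp only [pow_zero, pow_one, one_mul, mul_one, h4, if_false] at h2 h3
    rw [Finset.prod_pair hq2.symm, h2, h3]
    have hodd : Odd q := hq.odd_of_ne_two hq2
    rw [hilbertSymbolInf_natCast, jacobiSym.at_two hodd]
    rcases χ₈_eq_one_or (not_two_dvd hq hq2) with h | h <;> rw [Int.cast_natCast] at h <;> simp [h]

theorem prime_self : ProductFormula q q := by
  have := Fact.mk hq
  refine of_subset {2, q} (fun p hp h => ?_) (by simp [Nat.prime_two, hq]) ?_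
  · have : Fact p.Prime := ⟨hp⟩
    simp at h
    exact ⟨h.1, not_dvd_natCast hp hq h.2, not_dvd_natCast hp hq h.2⟩
  · have h2 := hilbertSymbol_two_pow_mul (not_two_dvd hq hq2) (not_two_dvd hq hq2) 0 0
    have h3 := hilbertSymbol_pow_mul (p := q) hq2 (u := 1) (v := 1)
      (by simpa using not_dvd_neg_one (p := q)) (by simpa using not_dvd_neg_one (p := q)) 1 1
    simp only [pow_zero, pow_one, one_mul, mul_one] at h2 h3
    rw [Finset.prod_pair hq2.symm, h2, h3]
    have hodd : Odd q := hq.odd_of_ne_two hq2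
    rw [hilbertSymbolInf_natCast, jacobiSym.at_neg_one hodd]
    rcases χ₄_eq_one_or (not_two_dvd hq hq2) with h | h <;> rw [Int.cast_natCast] at h <;> simp [h]

/-- The symbols at `q` and `r` are the two Legendre symbols, and the one at 2 is the sign in the
reciprocity law. -/
theorem prime_prime {r : ℕ} (hr : r.Prime) (hr2 : r ≠ 2) (hne : q ≠ r) :
    ProductFormula q r := by
  have := Fact.mk hq
  have := Fact.mk hr
  refine of_subset {2, q, r} (fun p hp h => ?_) (by simp [Nat.prime_two, hq, hr]) ?_
  · have : Fact p.Prime := ⟨hp⟩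
    simp at h
    exact ⟨h.1, not_dvd_natCast hp hq h.2.1, not_dvd_natCast hp hr h.2.2⟩
  · have h2 := hilbertSymbol_two_pow_mul (not_two_dvd hq hq2) (not_two_dvd hr hr2) 0 0
    have h3 := hilbertSymbol_pow_mul (p := q) hq2 (u := 1) (v := r)
      (by simpa using not_dvd_neg_one (p := q)) (not_dvd_natCast hq hr hne) 1 0
    have h4 := hilbertSymbol_pow_mul (p := r) hr2 (u := q) (v := 1)
      (not_dvd_natCast hr hq hne.symm) (by simpa using not_dvd_neg_one (p := r)) 0 1
    simp only [pow_zero, pow_one, one_mul, mul_one] at h2 h3 h4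
    rw [Finset.prod_insert (by simp [hq2.symm, hr2.symm]), Finset.prod_pair hne, h2, h3, h4]
    have hodd : Odd q := hq.odd_of_ne_two hq2
    rw [hilbertSymbolInf_natCast, Int.cast_natCast, Int.cast_natCast]
    have hrodd : Odd r := hr.odd_of_ne_two hr2
    have hJ := jacobiSym_eq_one_or (not_dvd_natCast hr hq hne.symm)
    rcases Nat.odd_mod_four_iff.1 (Nat.odd_iff.1 hodd) with hm | hm
    · rw [χ₄_nat_one_mod_four hm, jacobiSym.quadratic_reciprocity_one_mod_four hm hrodd] at *
      rcases hJ with h | h <;> simp [h]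
    · rcases Nat.odd_mod_four_iff.1 (Nat.odd_iff.1 hrodd) with hm' | hm'
      · rw [χ₄_nat_one_mod_four hm', jacobiSym.quadratic_reciprocity_one_mod_four' hodd hm'] at *
        rcases hJ with h | h <;> simp [h]
      · rw [χ₄_nat_three_mod_four hm', χ₄_nat_three_mod_four hm,
          jacobiSym.quadratic_reciprocity_three_mod_four hm hm'] at *
        rcases hJ with h | h <;> [skip; rw [neg_eq_iff_eq_neg, neg_neg] at h] <;> simp_all

end ProductFormula

/-- Symmetry and bilinearity reduce the claim to pairs taken from -1 and the primes. -/
theorem productFormula {a b : ℤ} (ha : a ≠ 0) (hb : b ≠ 0) : ProductFormula a b := by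
  have p0 {p : ℕ} (hp : p.Prime) : (p : ℤ) ≠ 0 := by exact_mod_cast hp.ne_zero
  have neg_one : ∀ b : ℤ, b ≠ 0 → ProductFormula (-1) b := by
    intro b hb
    refine Int.induction_on_neg_one_primes (P := fun b => ProductFormula (-1) b)
      ProductFormula.neg_one_neg_one (fun p hp => ?_) (fun c d hc hd h h' => ?_) hb
    · by_cases h2 : p = 2
      · subst h2
        exact (ProductFormula.two_left (Or.inl rfl)).symm (by simp) (by simp)
      · exact ProductFormula.neg_one_prime hp h2
    · exact ((h.symm (by simp) hc).mul_left hc hd (by simp) (h'.symm (by simp) hd)).symm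
        (mul_ne_zero hc hd) (by simp)
  refine Int.induction_on_neg_one_primes (P := fun b => ProductFormula a b)
    ((neg_one a ha).symm (by simp) ha) (fun p hp => ?_) (fun c d hc hd h h' => ?_) hb
  · refine Int.induction_on_neg_one_primes (P := fun a => ProductFormula a p)
      (neg_one p (p0 hp)) (fun q hq => ?_)
      (fun c d hc hd h h' => h.mul_left hc hd (p0 hp) h') ha
    by_cases h2 : p = 2
    · subst h2
      by_cases h2' : q = 2
      · subst h2'
        exact ProductFormula.two_left (Or.inr rfl)
      · exact (ProductFormula.two_prime hq h2').symm (by simp) (p0 hq)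
    · by_cases h2' : q = 2
      · subst h2'
        exact ProductFormula.two_prime hp h2
      · by_cases hpq : q = p
        · subst hpq
          exact ProductFormula.prime_self hq h2
        · exact ProductFormula.prime_prime hq h2' hp h2 hpq
  · exact ((h.symm ha hc).mul_left hc hd ha (h'.symm ha hd)).symm (mul_ne_zero hc hd) ha

end ProductFormula

/-! ### The Hilbert symbol decides local splitting -/

section LocalSymbol

open ZMod
open scoped NumberTheorySymbols

variable {p : ℕ} [hp : Fact p.Prime]

/-- If z² + z = w then (1 + 2z)² = 1 + 4w. The polynomial z² + z - w has derivative 1 at 0, so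
Hensel's lemma applies uniformly, including at p = 2. -/
theorem isSquare_one_add_four_mul {w : ℚ_[p]} (hw : ‖w‖ < 1) : IsSquare (1 + 4 * w) := by
  let W : ℤ_[p] := ⟨w, hw.le⟩
  let F : Polynomial ℤ_[p] := .X ^ 2 + .X - .C W
  obtain ⟨z, hz, -⟩ := hensels_lemma (F := F) (a := (0 : ℤ_[p])) (by
    simp [F]
    exact hw)
  have hz' : z ^ 2 + z = W := by
    simpa [F, sub_eq_zero] using hz
  have hz'' : (z : ℚ_[p]) ^ 2 + z = w := by
    have := congrArg (fun t : ℤ_[p] => (t : ℚ_[p])) hz'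
    simpa using this
  exact ⟨1 + 2 * z, by rw [← hz'']; ring⟩

/-- Two `p`-adic numbers that are close enough lie in the same square class. -/
theorem exists_eq_mul_sq {m n : ℚ_[p]} (h : ‖n - m‖ < ‖4 * m‖) : ∃ r ≠ 0, n = m * r ^ 2 := by
  have h0 : 0 < ‖4 * m‖ := (norm_nonneg _).trans_lt h
  have hm : m ≠ 0 := by rintro rfl; simp at h0
  have hw : ‖(n - m) / (4 * m)‖ < 1 := by rwa [norm_div, div_lt_one h0]
  obtain ⟨r, hr⟩ := isSquare_one_add_four_mul hw
  have hn : n = m * r ^ 2 := by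
    rw [sq, ← hr]
    field_simp
    ring
  refine ⟨r, ?_, hn⟩
  rintro rfl
  rw [hn] at h
  simp at h
  have : ‖(4 : ℚ_[p])‖ ≤ 1 := by exact_mod_cast Padic.norm_int_le_one (p := p) 4
  nlinarith [norm_nonneg m]

theorem hilbertSymbol_neg_self {a : ℤ} (ha : a ≠ 0) : hilbertSymbol p a (-a) = 1 := by
  obtain ⟨k, u, hu, rfl⟩ := exists_eq_pow_mul_not_dvd p ha
  have hu' : ¬ (p : ℤ) ∣ -u := by rwa [Int.dvd_neg]
  rw [← mul_neg]
  by_cases h2 : p = 2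
  · subst h2
    rw [Nat.cast_ofNat] at *
    have h4 : ∀ x : ZMod 4, χ₄ (-x) = -χ₄ x := by decide
    have h8 : ∀ x : ZMod 8, χ₈ (-x) = χ₈ x := by decide
    rw [hilbertSymbol_two_pow_mul hu hu']
    push_cast
    rw [h4, h8, mul_assoc, ← mul_pow]
    rcases χ₄_eq_one_or hu with h | h <;> rcases χ₈_eq_one_or hu with h' | h' <;> simp [h, h']
  · rw [hilbertSymbol_pow_mul h2 hu hu', ← neg_one_mul u, jacobiSym.mul_left]
    have h1 := jacobiSym_eq_one_or (p := p) not_dvd_neg_one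
    rcases jacobiSym_eq_one_or hu with h | h <;> rcases h1 with h1 | h1 <;> rw [h, h1] <;>
      simp [← pow_add, parity_simps]

/-- The Hilbert symbol of `a` and `b` detects splitting of `(a, b)` over `ℚ_[p]`. -/
def SymbolDetects (p : ℕ) [Fact p.Prime] (a b : ℤ) : Prop :=
  IsNormFrom (a : ℚ_[p]) (b : ℚ_[p]) ↔ hilbertSymbol p a b = 1

namespace SymbolDetects

theorem symm {a b : ℤ} (ha : a ≠ 0) (hb : b ≠ 0) (h : SymbolDetects p a b) :
    SymbolDetects p b a := by
  unfold SymbolDetects at *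
  rwa [IsNormFrom.comm (by exact_mod_cast hb) (by exact_mod_cast ha), hilbertSymbol_comm hb ha]

theorem mul_sq {a b r : ℤ} (ha : a ≠ 0) (hb : b ≠ 0) (hr : r ≠ 0) (h : SymbolDetects p a b) :
    SymbolDetects p (a * r ^ 2) b := by
  unfold SymbolDetects at *
  rw [hilbertSymbol_mul_sq_left ha hb hr]
  push_cast
  rwa [IsNormFrom.sq_mul_left_iff (by exact_mod_cast hr)]

/-- Since -a is a norm from K(√a), neither side changes when `b` is multiplied by -a. This handles
two arguments of odd valuation, as their product has even valuation. -/
theorem of_neg_mul {a b : ℤ} (ha : a ≠ 0) (hb : b ≠ 0) (h : SymbolDetects p a (-(a * b))) :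
    SymbolDetects p a b := by
  unfold SymbolDetects at *
  rw [← neg_mul, hilbertSymbol_mul_right ha (neg_ne_zero.2 ha) hb, hilbertSymbol_neg_self ha,
    one_mul] at h
  push_cast at h
  rwa [neg_mul, IsNormFrom.neg_mul_iff (by exact_mod_cast ha)] at h

/-- It suffices to treat the case that `a` is prime to `p` and `b` is not divisible by `p²`. -/
theorem of_units {a b : ℤ} (ha : a ≠ 0) (hb : b ≠ 0)
    (h0 : ∀ u v : ℤ, ¬ (p : ℤ) ∣ u → ¬ (p : ℤ) ∣ v → SymbolDetects p u v)
    (h1 : ∀ u v : ℤ, ¬ (p : ℤ) ∣ u → ¬ (p : ℤ) ∣ v → SymbolDetects p u (p * v)) :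
    SymbolDetects p a b := by
  have hp0 : (p : ℤ) ≠ 0 := by exact_mod_cast hp.out.ne_zero
  have ne0 {u : ℤ} (hu : ¬ (p : ℤ) ∣ u) : u ≠ 0 := by rintro rfl; simp at hu
  have red : ∀ a b : ℤ, a ≠ 0 → b ≠ 0 →
      (∀ u, ¬ (p : ℤ) ∣ u → SymbolDetects p u b ∧ SymbolDetects p (p * u) b) →
      SymbolDetects p a b := by
    intro a b ha hb h
    obtain ⟨k, u, hu, rfl⟩ := exists_eq_pow_mul_not_dvd p ha
    obtain ⟨j, rfl | rfl⟩ := Nat.even_or_odd' k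
    · have := (h u hu).1.mul_sq (ne0 hu) hb (pow_ne_zero j hp0)
      rwa [show (p : ℤ) ^ (2 * j) * u = u * ((p : ℤ) ^ j) ^ 2 by ring]
    · have := (h u hu).2.mul_sq (mul_ne_zero hp0 (ne0 hu)) hb (pow_ne_zero j hp0)
      rwa [show (p : ℤ) ^ (2 * j + 1) * u = p * u * ((p : ℤ) ^ j) ^ 2 by ring]
  refine red a b ha hb fun u hu => ⟨?_, ?_⟩
  · exact (red b u hb (ne0 hu) fun v hv => ⟨h0 v u hv hu,
      (h1 u v hu hv).symm (ne0 hu) (mul_ne_zero hp0 (ne0 hv))⟩).symm hb (ne0 hu)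
  · have hpu := mul_ne_zero hp0 (ne0 hu)
    refine (red b (p * u) hb hpu fun v hv => ⟨h1 v u hv hu, ?_⟩).symm hb hpu
    have hpv := mul_ne_zero hp0 (ne0 hv)
    have huv : ¬ (p : ℤ) ∣ -(v * u) := by rw [Int.dvd_neg]; exact not_dvd_mul hv hu
    refine of_neg_mul hpv hpu ?_
    have := ((h1 (-(v * u)) v huv hv).mul_sq (ne0 huv) hpv hp0).symm
      (mul_ne_zero (ne0 huv) (pow_ne_zero 2 hp0)) hpv
    rwa [show -(p * v * (p * u)) = -(v * u) * (p : ℤ) ^ 2 by ring]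

end SymbolDetects

theorem norm_intCast_eq_one {u : ℤ} (hu : ¬ (p : ℤ) ∣ u) : ‖(u : ℚ_[p])‖ = 1 :=
  le_antisymm (Padic.norm_int_le_one u)
    (not_lt.1 fun h => hu (Padic.norm_intCast_lt_one_iff.1 h))

/-- A representation as a norm over `ℚ_[p]` can be scaled to a primitive solution over `ℤ_[p]`. -/
theorem exists_primitive_of_isNormFrom {a b : ℤ} (h : IsNormFrom (a : ℚ_[p]) (b : ℚ_[p])) :
    ∃ X Y Z : ℤ_[p], X ^ 2 - a * Y ^ 2 = b * Z ^ 2 ∧ (X = 1 ∨ Y = 1 ∨ Z = 1) := by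
  obtain ⟨x, y, h⟩ := h
  have scale : ∀ m : ℚ_[p], m ≠ 0 → ‖x‖ ≤ ‖m‖ → ‖y‖ ≤ ‖m‖ → 1 ≤ ‖m‖ → (m = x ∨ m = y ∨ m = 1) →
      ∃ X Y Z : ℤ_[p], X ^ 2 - a * Y ^ 2 = b * Z ^ 2 ∧ (X = 1 ∨ Y = 1 ∨ Z = 1) := by
    intro m hm hx hy h1 hor
    have h0 := norm_pos_iff.2 hm
    have lift : ∀ t : ℚ_[p], ‖t‖ ≤ ‖m‖ → ∃ T : ℤ_[p], (T : ℚ_[p]) = t / m := fun t ht =>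
      ⟨⟨t / m, by rwa [norm_div, div_le_one h0]⟩, rfl⟩
    obtain ⟨X, hX⟩ := lift x hx
    obtain ⟨Y, hY⟩ := lift y hy
    obtain ⟨Z, hZ⟩ := lift 1 (by rwa [norm_one])
    refine ⟨X, Y, Z, ?_, ?_⟩
    · apply PadicInt.ext
      push_cast
      rw [hX, hY, hZ]
      field_simp
      linear_combination h
    · rcases hor with rfl | rfl | rfl
      · exact Or.inl (PadicInt.ext (by rw [hX, div_self hm, PadicInt.coe_one]))
      · exact Or.inr (Or.inl (PadicInt.ext (by rw [hY, div_self hm, PadicInt.coe_one])))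
      · exact Or.inr (Or.inr (PadicInt.ext (by rw [hZ, div_self hm, PadicInt.coe_one])))
  have ne {m : ℚ_[p]} (h : 1 ≤ ‖m‖) : m ≠ 0 := by rintro rfl; simp at h; linarith
  rcases le_total ‖x‖ ‖y‖ with hxy | hxy
  · rcases le_total ‖y‖ 1 with h1 | h1
    · exact scale 1 one_ne_zero (by simpa using hxy.trans h1) (by simpa using h1) (by simp) (by simp)
    · exact scale y (ne h1) hxy le_rfl h1 (by simp)
  · rcases le_total ‖x‖ 1 with h1 | h1
    · exact scale 1 one_ne_zero (by simpa using h1) (by simpa using hxy.trans h1) (by simp) (by simp)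
    · exact scale x (ne h1) le_rfl hxy h1 (by simp)

section Odd

variable (h2 : p ≠ 2)
include h2

theorem exists_eq_mul_sq_of_dvd_sub {m n : ℤ} (hm : ¬ (p : ℤ) ∣ m) (h : (p : ℤ) ∣ n - m) :
    ∃ r : ℚ_[p], r ≠ 0 ∧ (n : ℚ_[p]) = m * r ^ 2 := by
  apply exists_eq_mul_sq
  have h4 : ¬ (p : ℤ) ∣ 4 * m := by
    refine not_dvd_mul ?_ hm
    have : ¬ (p : ℤ) ∣ 2 := by
      exact_mod_cast ProductFormula.not_dvd_natCast hp.out Nat.prime_two h2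
    exact not_dvd_mul this this
  have := norm_intCast_eq_one h4
  push_cast at this
  rw [this]
  exact_mod_cast Padic.norm_intCast_lt_one_iff.2 h

theorem isSquare_of_jacobiSym_eq_one {u : ℤ} (hu : ¬ (p : ℤ) ∣ u) (h : J(u | p) = 1) :
    IsSquare (u : ℚ_[p]) := by
  obtain ⟨x, hx⟩ := ZMod.isSquare_of_jacobiSym_eq_one h
  obtain ⟨x, rfl⟩ := ZMod.intCast_surjective x
  have hd : (p : ℤ) ∣ u - x * x := by
    rw [← ZMod.intCast_zmod_eq_zero_iff_dvd]
    push_cast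
    rw [hx, sub_self]
  have hx : ¬ (p : ℤ) ∣ x * x := fun h => hu ((Int.dvd_iff_dvd_of_dvd_sub hd).2 h)
  obtain ⟨r, -, hr⟩ := exists_eq_mul_sq_of_dvd_sub h2 hx hd
  exact ⟨x * r, by rw [hr]; push_cast; ring⟩

/-- The equation x² - u y² = v has a solution modulo p, and a unit congruent to `v` lies in the same
square class. -/
theorem isNormFrom_of_not_dvd {u v : ℤ} (hu : ¬ (p : ℤ) ∣ u) (hv : ¬ (p : ℤ) ∣ v) :
    IsNormFrom (u : ℚ_[p]) (v : ℚ_[p]) := by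
  have hu' : (u : ZMod p) ≠ 0 := by rwa [Ne, ZMod.intCast_zmod_eq_zero_iff_dvd]
  obtain ⟨x, y, hxy⟩ := FiniteField.exists_root_sum_quadratic (R := ZMod p)
    (f := .X ^ 2 - .C (v : ZMod p)) (g := .C (-(u : ZMod p)) * .X ^ 2) 
    (Polynomial.degree_X_pow_sub_C (by norm_num) _)
    (Polynomial.degree_C_mul_X_pow 2 (neg_ne_zero.2 hu')) (by
      rw [ZMod.card]; exact Nat.odd_iff.1 (hp.out.odd_of_ne_two h2))
  obtain ⟨x, rfl⟩ := ZMod.intCast_surjective x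
  obtain ⟨y, rfl⟩ := ZMod.intCast_surjective y
  have hd : (p : ℤ) ∣ v - (x ^ 2 - u * y ^ 2) := by
    rw [← ZMod.intCast_zmod_eq_zero_iff_dvd]
    simp at hxy
    push_cast
    linear_combination -hxy
  obtain ⟨r, -, hr⟩ := exists_eq_mul_sq_of_dvd_sub h2
    (fun h => hv ((Int.dvd_iff_dvd_of_dvd_sub hd).2 h)) hd
  rw [hr]
  exact IsNormFrom.mul ⟨x, y, by push_cast; ring⟩ (IsNormFrom.sq _ _)

theorem symbolDetects_mul_of_ne_two {u v : ℤ} (hu : ¬ (p : ℤ) ∣ u) (hv : ¬ (p : ℤ) ∣ v) :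
    SymbolDetects p u (p * v) := by
  have hs := hilbertSymbol_pow_mul h2 hu hv 0 1
  simp only [pow_zero, one_mul, pow_one, mul_one] at hs
  unfold SymbolDetects
  rw [hs]
  constructor
  · intro h
    -- If `u` were a nonresidue, reducing a primitive solution modulo p would make X and Y divisible
    -- by p. Then p² divides p v Z², so p divides Z as well, contradicting primitivity.
    refine (jacobiSym_eq_one_or hu).resolve_right fun hJ => ?_
    obtain ⟨x, y, hxy⟩ := h
    obtain ⟨X, Y, Z, h, h1⟩ := exists_primitive_of_isNormFrom (a := u) (b := p * v)
      (by push_cast; exact ⟨x, y, by exact_mod_cast hxy⟩)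
    have hp0 : (p : ℤ_[p]) ≠ 0 := by exact_mod_cast hp.out.ne_zero
    have key (T : ℤ_[p]) : PadicInt.toZMod T = 0 ↔ (p : ℤ_[p]) ∣ T := by
      rw [← RingHom.mem_ker, PadicInt.ker_toZMod, PadicInt.maximalIdeal_eq_span_p,
        Ideal.mem_span_singleton]
    have e := congrArg PadicInt.toZMod h
    simp at e
    have hY : PadicInt.toZMod Y = 0 := by
      by_contra hY
      refine ZMod.nonsquare_of_jacobiSym_eq_neg_one hJ
        ⟨PadicInt.toZMod X / PadicInt.toZMod Y, ?_⟩
      field_simp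
      linear_combination -e
    have hX : PadicInt.toZMod X = 0 := by simpa [hY] using e
    obtain ⟨X', rfl⟩ := (key X).1 hX
    obtain ⟨Y', rfl⟩ := (key Y).1 hY
    have e' : (p : ℤ_[p]) * (X' ^ 2 - u * Y' ^ 2) = v * Z ^ 2 := by
      apply mul_left_cancel₀ hp0
      push_cast at h
      linear_combination h
    have hZ : PadicInt.toZMod Z = 0 := by
      have := congrArg PadicInt.toZMod e'
      have hv' : (v : ZMod p) ≠ 0 := by rwa [Ne, ZMod.intCast_zmod_eq_zero_iff_dvd]
      simpa [hv'] using this.symm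
    rcases h1 with h1 | h1 | h1
    · simp [h1] at hX
    · simp [h1] at hY
    · simp [h1] at hZ
  · intro h
    refine IsNormFrom.of_isSquare ?_ (isSquare_of_jacobiSym_eq_one h2 hu h) _
    intro h0
    have : u = 0 := by exact_mod_cast h0
    simp [this] at hu

end Odd

section Two

/-- The exponent k + 3 places the approximation error strictly below |4 · 2^k v| = 2^(-k-2), so both
numbers lie in one square class. -/
theorem isNormFrom_of_two_pow_dvd {u v x y : ℤ} {k : ℕ} (hv : ¬ (2 : ℤ) ∣ v)
    (h : (2 : ℤ) ^ (k + 3) ∣ x ^ 2 - u * y ^ 2 - 2 ^ k * v) :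
    IsNormFrom (u : ℚ_[2]) ((2 ^ k * v : ℤ) : ℚ_[2]) := by
  obtain ⟨r, hr, h⟩ := exists_eq_mul_sq (p := 2) (m := ((2 ^ k * v : ℤ) : ℚ_[2]))
    (n := ((x ^ 2 - u * y ^ 2 : ℤ) : ℚ_[2])) (by
      have h1 : ‖(2 : ℚ_[2])‖ = 2⁻¹ := by simpa using Padic.norm_p (p := 2)
      have h2 : ‖(v : ℚ_[2])‖ = 1 := norm_intCast_eq_one (p := 2) hv
      have h3 : ‖(4 : ℚ_[2])‖ = 2⁻¹ ^ 2 := by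
        rw [show (4 : ℚ_[2]) = 2 ^ 2 by norm_num, norm_pow, h1]
      rw [← Int.cast_sub]
      refine ((Padic.norm_int_le_pow_iff_dvd (p := 2) _ (k + 3)).2 (by exact_mod_cast h)).trans_lt ?_
      push_cast
      rw [norm_mul, norm_mul, norm_pow, h1, h2, h3, zpow_neg,
        show (k : ℤ) + 3 = (k + 3 : ℕ) by norm_num, zpow_natCast, ← inv_pow, mul_one,
        ← pow_add]
      exact pow_lt_pow_right_of_lt_one₀ (by norm_num) (by norm_num) (by omega))
  exact IsNormFrom.of_mul_sq hr ⟨x, y, by rw [← h]; push_cast; ring⟩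

theorem cast_χ₄ (u : ℤ) : χ₄ (u : ZMod 4) = χ₄ (ZMod.cast (u : ZMod 8) : ZMod 4) := by
  rw [ZMod.cast_intCast (by norm_num)]

theorem intCast_zmod_eight_sq {u : ℤ} (hu : ¬ (2 : ℤ) ∣ u) : (u : ZMod 8) ^ 2 = 1 := by
  have h : u % 8 = 1 ∨ u % 8 = 3 ∨ u % 8 = 5 ∨ u % 8 = 7 := by omega
  rw [← ZMod.intCast_mod]
  rcases h with h | h | h | h <;> (push_cast at h ⊢; rw [h]; decide)

theorem dyadic_unit_sufficient : ∀ U : ZMod 8, U ^ 2 = 1 → ∀ V : ZMod 8, V ^ 2 = 1 →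
    (if χ₄ (ZMod.cast U : ZMod 4) = -1 then χ₄ (ZMod.cast V : ZMod 4) else 1) = 1 →
      ∃ X Y : ZMod 8, X ^ 2 - U * Y ^ 2 = V := by
  decide

theorem dyadic_unit_necessary : ∀ U : ZMod 8, U ^ 2 = 1 → ∀ V : ZMod 8, V ^ 2 = 1 →
    ∀ X Y Z : ZMod 8, X ^ 2 - U * Y ^ 2 = V * Z ^ 2 → (X = 1 ∨ Y = 1 ∨ Z = 1) →
    (if χ₄ (ZMod.cast U : ZMod 4) = -1 then χ₄ (ZMod.cast V : ZMod 4) else 1) = 1 := by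
  decide

/-- The classes 1 and 9 are exceptions because x² - U y² is then never 2 modulo 4; such `u` are
2-adic squares and are treated separately. The hypotheses on squares say that U and V are odd. -/
theorem dyadic_prime_sufficient : ∀ U : ZMod 16, U ^ 2 = 1 ∨ U ^ 2 = 9 →
    ∀ V : ZMod 16, V ^ 2 = 1 ∨ V ^ 2 = 9 →
    (if χ₄ (ZMod.cast U : ZMod 4) = -1 then χ₄ (ZMod.cast V : ZMod 4) else 1) *
      χ₈ (ZMod.cast U : ZMod 8) = 1 →
      U = 1 ∨ U = 9 ∨ ∃ X Y : ZMod 16, X ^ 2 - U * Y ^ 2 = 2 * V := by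
  decide

theorem dyadic_prime_necessary : ∀ U : ZMod 8, U ^ 2 = 1 → ∀ V : ZMod 8, V ^ 2 = 1 →
    ∀ X Y Z : ZMod 8, X ^ 2 - U * Y ^ 2 = 2 * V * Z ^ 2 → (X = 1 ∨ Y = 1 ∨ Z = 1) →
    (if χ₄ (ZMod.cast U : ZMod 4) = -1 then χ₄ (ZMod.cast V : ZMod 4) else 1) * χ₈ U = 1 := by
  decide

theorem symbolDetects_two_units {u v : ℤ} (hu : ¬ (2 : ℤ) ∣ u) (hv : ¬ (2 : ℤ) ∣ v) :
    SymbolDetects 2 u v := by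
  have hs := hilbertSymbol_two_pow_mul hu hv 0 0
  simp only [pow_zero, one_mul, mul_one] at hs
  have hU := intCast_zmod_eight_sq hu
  have hV := intCast_zmod_eight_sq hv
  unfold SymbolDetects
  rw [hs, cast_χ₄, cast_χ₄]
  constructor
  · intro h
    obtain ⟨X, Y, Z, h, h1⟩ := exists_primitive_of_isNormFrom h
    have e := congrArg (PadicInt.toZModPow (p := 2) 3) h
    simp only [map_sub, map_mul, map_pow, map_intCast] at e
    refine dyadic_unit_necessary _ hU _ hV _ _ _ e ?_
    rcases h1 with rfl | rfl | rfl <;> simp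
  · intro h
    obtain ⟨x, y, hxy⟩ := dyadic_unit_sufficient _ hU _ hV h
    obtain ⟨x, rfl⟩ := ZMod.intCast_surjective x
    obtain ⟨y, rfl⟩ := ZMod.intCast_surjective y
    have := isNormFrom_of_two_pow_dvd (u := u) (x := x) (y := y) (k := 0) hv (by
      have := (ZMod.intCast_zmod_eq_zero_iff_dvd (x ^ 2 - u * y ^ 2 - 2 ^ 0 * v) 8).1
        (by push_cast; linear_combination hxy)
      exact_mod_cast this)
    simpa using this

theorem isSquare_of_mod_eight {u : ℤ} (hu : (8 : ℤ) ∣ u - 1) : IsSquare (u : ℚ_[2]) := by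
  obtain ⟨r, -, h⟩ := exists_eq_mul_sq (p := 2) (m := 1) (n := (u : ℚ_[2])) (by
    have h1 : ‖(2 : ℚ_[2])‖ = 2⁻¹ := by simpa using Padic.norm_p (p := 2)
    rw [mul_one, show (4 : ℚ_[2]) = 2 ^ 2 by norm_num, norm_pow, h1]
    have := (Padic.norm_int_le_pow_iff_dvd (p := 2) (u - 1) 3).2 (by exact_mod_cast hu)
    push_cast at this
    refine this.trans_lt ?_
    rw [zpow_neg, show (3 : ℤ) = (3 : ℕ) by norm_num, zpow_natCast]
    norm_num)
  exact ⟨r, by rw [h]; ring⟩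

theorem symbolDetects_two_mul {u v : ℤ} (hu : ¬ (2 : ℤ) ∣ u) (hv : ¬ (2 : ℤ) ∣ v) :
    SymbolDetects 2 u (2 * v) := by
  have hs := hilbertSymbol_two_pow_mul hu hv 0 1
  simp only [pow_zero, pow_one, one_mul, mul_one] at hs
  unfold SymbolDetects
  rw [hs]
  constructor
  · intro h
    have hU := intCast_zmod_eight_sq hu
    have hV := intCast_zmod_eight_sq hv
    obtain ⟨X, Y, Z, h, h1⟩ := exists_primitive_of_isNormFrom (b := 2 * v) h
    have e := congrArg (PadicInt.toZModPow (p := 2) 3) h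
    push_cast at e
    simp only [map_sub, map_mul, map_pow, map_intCast, map_ofNat] at e
    rw [cast_χ₄, cast_χ₄]
    refine dyadic_prime_necessary _ hU _ hV _ _ _ e ?_
    rcases h1 with rfl | rfl | rfl <;> simp
  · intro h
    have sq16 : ∀ w : ℤ, ¬ (2 : ℤ) ∣ w → (w : ZMod 16) ^ 2 = 1 ∨ (w : ZMod 16) ^ 2 = 9 := by
      intro w hw
      obtain ⟨m, rfl⟩ : ∃ m, w = 2 * m + 1 := ⟨w / 2, by omega⟩
      push_cast
      generalize (m : ZMod 16) = M
      revert M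
      decide
    have h4 : ∀ w : ℤ, χ₄ (w : ZMod 4) = χ₄ (ZMod.cast (w : ZMod 16) : ZMod 4) := fun w => by
      rw [ZMod.cast_intCast (by norm_num)]
    have h8 : ∀ w : ℤ, χ₈ (w : ZMod 8) = χ₈ (ZMod.cast (w : ZMod 16) : ZMod 8) := fun w => by
      rw [ZMod.cast_intCast (by norm_num)]
    rw [h4, h4, h8] at h
    have sq (hd : (8 : ℤ) ∣ u - 1) : IsNormFrom (u : ℚ_[2]) ((2 * v : ℤ) : ℚ_[2]) := by
      refine IsNormFrom.of_isSquare ?_ (isSquare_of_mod_eight hd) _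
      have : u ≠ 0 := by rintro rfl; simp at hu
      exact_mod_cast this
    rcases dyadic_prime_sufficient _ (sq16 u hu) _ (sq16 v hv) h with hU | hU | ⟨x, y, hxy⟩
    · have := (ZMod.intCast_zmod_eq_zero_iff_dvd (u - 1) 16).1 (by push_cast; rw [hU]; ring)
      exact sq (by omega)
    · have := (ZMod.intCast_zmod_eq_zero_iff_dvd (u - 9) 16).1 (by push_cast; rw [hU]; ring)
      exact sq (by omega)
    · obtain ⟨x, rfl⟩ := ZMod.intCast_surjective x
      obtain ⟨y, rfl⟩ := ZMod.intCast_surjective y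
      have := isNormFrom_of_two_pow_dvd (u := u) (x := x) (y := y) (k := 1) hv (by
        have := (ZMod.intCast_zmod_eq_zero_iff_dvd (x ^ 2 - u * y ^ 2 - 2 ^ 1 * v) 16).1
          (by push_cast; linear_combination hxy)
        exact_mod_cast this)
      simpa using this

end Two

/-- The explicit Hilbert symbol detects whether the quaternion algebra `(a, b)` splits over
`ℚ_[p]`. -/
theorem isNormFrom_padic_iff {a b : ℤ} (ha : a ≠ 0) (hb : b ≠ 0) :
    IsNormFrom (a : ℚ_[p]) (b : ℚ_[p]) ↔ hilbertSymbol p a b = 1 := by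
  refine SymbolDetects.of_units ha hb (fun u v hu hv => ?_) (fun u v hu hv => ?_)
  · by_cases h2 : p = 2
    · subst h2
      exact symbolDetects_two_units hu hv
    · exact iff_of_true (isNormFrom_of_not_dvd h2 hu hv) (hilbertSymbol_of_not_dvd h2 hu hv)
  · by_cases h2 : p = 2
    · subst h2
      exact symbolDetects_two_mul hu hv
    · exact symbolDetects_mul_of_ne_two h2 hu hv

theorem isNormFrom_real_iff {a b : ℤ} (ha : a ≠ 0) (hb : b ≠ 0) :
    IsNormFrom (a : ℝ) (b : ℝ) ↔ hilbertSymbolInf a b = 1 := by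
  unfold hilbertSymbolInf
  constructor
  · rintro ⟨x, y, h⟩
    rw [if_neg]
    rintro ⟨h1, h2⟩
    have h1' : (a : ℝ) < 0 := by exact_mod_cast h1
    have h2' : (b : ℝ) < 0 := by exact_mod_cast h2
    nlinarith [sq_nonneg x, sq_nonneg y, mul_nonneg (neg_nonneg.2 h1'.le) (sq_nonneg y)]
  · intro h
    have h' : ¬ (a < 0 ∧ b < 0) := fun h' => by simp [h'] at h
    have ha' : (a : ℝ) ≠ 0 := by exact_mod_cast ha
    have hb' : (b : ℝ) ≠ 0 := by exact_mod_cast hb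
    rcases ha.lt_or_gt with h1 | h1
    · have h2 : 0 ≤ b := not_lt.1 fun h2 => h' ⟨h1, h2⟩
      have h2' : 0 ≤ (b : ℝ) := by exact_mod_cast h2
      exact (IsNormFrom.of_isSquare hb' (Real.isSquare_iff.2 h2') _).symm ha'
    · have h1' : 0 ≤ (a : ℝ) := by exact_mod_cast h1.le
      exact IsNormFrom.of_isSquare ha' (Real.isSquare_iff.2 h1') _

end LocalSymbol

/-! ### Legendre's descent: the Hasse principle for x² - a y² = b -/

section HasseMinkowski

open scoped NumberTheorySymbols

/-- An integer that is a square modulo each prime factor of a squarefree number is a square modulo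
that number. -/
theorem exists_sq_sub_dvd_of_squarefree {a : ℤ} {n : ℕ} (hn : Squarefree n)
    (h : ∀ p : ℕ, p.Prime → p ∣ n → ∃ t : ℤ, (p : ℤ) ∣ t ^ 2 - a) :
    ∃ t : ℤ, (n : ℤ) ∣ t ^ 2 - a := by
  induction n using induction_on_primes with
  | zero => simp at hn
  | one => exact ⟨0, by simp⟩
  | prime_mul p n hp ih =>
    have hc : IsCoprime (p : ℤ) n := by
      rw [Int.isCoprime_iff_gcd_eq_one]
      exact_mod_cast Nat.coprime_of_squarefree_mul hn
    obtain ⟨x, c, hx⟩ := h p hp (dvd_mul_right _ _)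
    obtain ⟨y, d, hy⟩ := ih (hn.of_mul_right) fun q hq hqn => h q hq (hqn.mul_left _)
    obtain ⟨u, v, huv⟩ := id hc
    refine ⟨x * v * n + y * u * p, ?_⟩
    push_cast
    refine hc.mul_dvd ?_ ?_
    · have : x * v * n + y * u * p = x + p * (y * u - x * u) := by linear_combination x * huv
      rw [this]
      exact ⟨c + 2 * x * (y * u - x * u) + p * (y * u - x * u) ^ 2, by linear_combination hx⟩
    · have : x * v * n + y * u * p = y + n * (x * v - y * v) := by linear_combination y * huv
      rw [this]
      exact ⟨d + 2 * y * (x * v - y * v) + n * (x * v - y * v) ^ 2, by linear_combination hy⟩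

theorem exists_sq_sub_dvd_of_hilbertSymbol {p : ℕ} [hp : Fact p.Prime] {a b : ℤ} (hb : Squarefree b)
    (hpb : (p : ℤ) ∣ b) (h : hilbertSymbol p a b = 1) : ∃ t : ℤ, (p : ℤ) ∣ t ^ 2 - a := by
  by_cases h2 : p = 2
  · subst h2
    rcases Int.even_or_odd a with ha | ha
    · exact ⟨0, by push_cast; have := ha.two_dvd; omega⟩
    · exact ⟨1, by push_cast; obtain ⟨k, rfl⟩ := ha; omega⟩
  by_cases hpa : (p : ℤ) ∣ a
  · exact ⟨0, by simpa using hpa⟩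
  obtain ⟨c, rfl⟩ := hpb
  have hc : ¬ (p : ℤ) ∣ c := by
    rintro ⟨d, rfl⟩
    have := hb p ⟨d, by ring⟩
    exact (Nat.prime_iff_prime_int.1 hp.out).not_isUnit this
  have := hilbertSymbol_pow_mul h2 hpa hc 0 1
  simp only [pow_zero, one_mul, pow_one, mul_one] at this
  rw [this] at h
  obtain ⟨x, hx⟩ := ZMod.isSquare_of_jacobiSym_eq_one h
  obtain ⟨x, rfl⟩ := ZMod.intCast_surjective x
  refine ⟨x, (ZMod.intCast_zmod_eq_zero_iff_dvd _ _).1 ?_⟩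
  push_cast
  rw [hx]
  ring

/-- `a` and `b` have trivial Hilbert symbol at all places. -/
structure HilbertTrivial (a b : ℤ) : Prop where
  finite : ∀ (p : ℕ) [Fact p.Prime], hilbertSymbol p a b = 1
  infinite : hilbertSymbolInf a b = 1

namespace HilbertTrivial

theorem symm {a b : ℤ} (ha : a ≠ 0) (hb : b ≠ 0) (h : HilbertTrivial a b) : HilbertTrivial b a :=
  ⟨fun p _ => hilbertSymbol_comm (p := p) hb ha ▸ h.finite p, hilbertSymbolInf_comm b a ▸ h.infinite⟩

theorem of_mul_sq_left {a b r : ℤ} (ha : a ≠ 0) (hb : b ≠ 0) (hr : r ≠ 0)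
    (h : HilbertTrivial (a * r ^ 2) b) : HilbertTrivial a b := by
  refine ⟨fun p _ => hilbertSymbol_mul_sq_left (p := p) ha hb hr ▸ h.finite p, ?_⟩
  have := h.infinite
  have hr2 : 0 < r ^ 2 := by positivity
  simpa [hilbertSymbolInf, mul_neg_iff, hr2, hr2.not_gt] using this

/-- A global norm has trivial symbol at all places, so (a, b) and (a, c) agree everywhere by
bilinearity. -/
theorem of_mul_right_of_norm {a b c : ℤ} (ha : a ≠ 0) (hb : b ≠ 0) (hc : c ≠ 0)
    (h : HilbertTrivial a b) {x y : ℤ} (hn : x ^ 2 - a * y ^ 2 = b * c) : HilbertTrivial a c := by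
  have hbc := mul_ne_zero hb hc
  refine ⟨fun p _ => ?_, ?_⟩
  · have := (isNormFrom_padic_iff (p := p) ha hbc).1 ⟨x, y, by exact_mod_cast hn⟩
    rwa [hilbertSymbol_mul_right ha hb hc, h.finite p, one_mul] at this
  · have := (isNormFrom_real_iff ha hbc).1 ⟨x, y, by exact_mod_cast hn⟩
    rwa [hilbertSymbolInf_comm, hilbertSymbolInf_mul_left a hb hc, hilbertSymbolInf_comm b,
      h.infinite, one_mul, hilbertSymbolInf_comm] at this

end HilbertTrivial

/-- The Hasse principle for the norm form of a quadratic extension of `ℚ`. -/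
theorem isNormFrom_rat_of_hilbertTrivial {a b : ℤ} (ha : a ≠ 0) (hb : b ≠ 0)
    (h : HilbertTrivial a b) : IsNormFrom (a : ℚ) (b : ℚ) := by
  induction hN : a.natAbs + b.natAbs using Nat.strong_induction_on generalizing a b with
  | _ N ih =>
  subst hN
  wlog hab : a.natAbs ≤ b.natAbs generalizing a b
  · refine (this hb ha (h.symm ha hb) (fun M hM c d hc hd hcd e => ?_) (by omega)).symm
      (by exact_mod_cast ha)
    exact ih M (by omega) hc hd hcd e
  have haQ : (a : ℚ) ≠ 0 := by exact_mod_cast ha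
  by_cases hsf : Squarefree b
  swap
  · obtain ⟨r, ⟨c, rfl⟩, hr1⟩ : ∃ r, r * r ∣ b ∧ ¬ IsUnit r := by
      simpa [Squarefree] using hsf
    have hr : r ≠ 0 := by rintro rfl; simp at hb
    have hc : c ≠ 0 := by rintro rfl; simp at hb
    have hr2 : 2 ≤ r.natAbs := by
      rw [Int.isUnit_iff_natAbs_eq] at hr1
      have := Int.natAbs_ne_zero.2 hr
      omega
    rw [show r * r * c = c * r ^ 2 by ring] at h
    have h' := ((h.symm ha (by positivity)).of_mul_sq_left hc ha hr).symm hc ha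
    have := ih _ (by
      rw [Int.natAbs_mul, Int.natAbs_mul]
      have := Int.natAbs_pos.2 hc
      have : 1 < r.natAbs * r.natAbs := by nlinarith
      nlinarith) ha hc h' rfl
    rw [show ((r * r * c : ℤ) : ℚ) = c * (r : ℚ) ^ 2 by push_cast; ring]
    exact this.mul (IsNormFrom.sq _ _)
  by_cases hb1 : b.natAbs = 1
  · rcases Int.natAbs_eq_iff.1 hb1 with hb1 | hb1
    · exact ⟨1, 0, by rw [hb1]; simp⟩
    · have ha1 : a = 1 := by
        have hpos : ¬ a < 0 := fun h' => by
          have := h.infinite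
          simp [hilbertSymbolInf, h', hb1] at this
        omega
      exact IsNormFrom.of_isSquare haQ (by rw [ha1]; simp) _
  -- Descent: trivial symbols make `a` a square modulo `b`. With s² - a = bc and |s| ≤ |b|/2 one
  -- gets |c| ≤ |b|/4 + 1 < |b|, and `b` may be replaced by `c`.
  obtain ⟨t, ht⟩ := exists_sq_sub_dvd_of_squarefree (a := a) (Int.squarefree_natAbs.2 hsf)
    fun p hp hpb => by
      have := Fact.mk hp
      exact exists_sq_sub_dvd_of_hilbertSymbol hsf (Int.natCast_dvd.2 hpb) (h.finite p)
  rw [Int.natAbs_dvd] at ht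
  obtain ⟨s, hs, hs2⟩ : ∃ s : ℤ, b ∣ s ^ 2 - a ∧ 2 * s.natAbs ≤ b.natAbs := by
    refine ⟨t.bmod b.natAbs, ?_, ?_⟩
    · have h1 : b ∣ t.bmod b.natAbs - t := by
        rw [← Int.natAbs_dvd]; exact Int.dvd_bmod_sub_self
      have := (h1.mul_right (t.bmod b.natAbs + t)).add ht
      rwa [show (t.bmod b.natAbs - t) * (t.bmod b.natAbs + t) + (t ^ 2 - a) =
        t.bmod b.natAbs ^ 2 - a by ring] at this
    · have hpos := Int.natAbs_pos.2 hb
      have h1 := Int.bmod_le (x := t) hpos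
      have h2 := Int.le_bmod (x := t) hpos
      omega
  obtain ⟨c, hc⟩ := hs
  by_cases hc0 : c = 0
  · refine IsNormFrom.of_isSquare haQ ⟨s, ?_⟩ _
    have : s ^ 2 = a := by rw [hc0] at hc; linarith
    rw [← this]; push_cast; ring
  have key := ih _ (by
      have h1 : b.natAbs * c.natAbs ≤ s.natAbs ^ 2 + a.natAbs := by
        rw [← Int.natAbs_mul, ← hc, ← Int.natAbs_pow]
        exact Int.natAbs_sub_le _ _
      have h3 : 2 ≤ b.natAbs := by have := Int.natAbs_ne_zero.2 hb; omega
      have : c.natAbs < b.natAbs := by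
        by_contra! hcon
        have h4 : b.natAbs * b.natAbs ≤ b.natAbs * c.natAbs := Nat.mul_le_mul_left _ hcon
        have h5 : (2 * s.natAbs) ^ 2 ≤ b.natAbs ^ 2 := Nat.pow_le_pow_left hs2 2
        nlinarith
      omega) ha hc0 (h.of_mul_right_of_norm (x := s) (y := 1) ha hb hc0 (by linear_combination hc)) rfl
  refine IsNormFrom.cancel_left (b := (c : ℚ)) (by exact_mod_cast hc0) key ⟨s, 1, ?_⟩
  have : ((s ^ 2 - a : ℤ) : ℚ) = (b * c : ℤ) := by rw [hc]
  push_cast at this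
  linear_combination this

end HasseMinkowski

/-! ### Local-global construction of pure quaternions with given square -/

section Existence

/-- The formal properties shared by the Hilbert symbols at all places. -/
structure IsSymbol (H : ℤ → ℤ → ℤ) : Prop where
  comm : ∀ {a b : ℤ}, a ≠ 0 → b ≠ 0 → H a b = H b a
  mul_left : ∀ {a a' b : ℤ}, a ≠ 0 → a' ≠ 0 → b ≠ 0 → H (a * a') b = H a b * H a' b
  eq_one_or : ∀ {a b : ℤ}, a ≠ 0 → b ≠ 0 → H a b = 1 ∨ H a b = -1
  neg_self : ∀ {a : ℤ}, a ≠ 0 → H a (-a) = 1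

theorem isSymbol_hilbertSymbol (p : ℕ) [Fact p.Prime] : IsSymbol (hilbertSymbol p) :=
  ⟨hilbertSymbol_comm, hilbertSymbol_mul_left, hilbertSymbol_eq_one_or, hilbertSymbol_neg_self⟩

theorem isSymbol_hilbertSymbolInf : IsSymbol hilbertSymbolInf where
  comm _ _ := hilbertSymbolInf_comm _ _
  mul_left ha ha' _ := hilbertSymbolInf_mul_left _ ha ha'
  eq_one_or _ _ := hilbertSymbolInf_eq_one_or _ _
  neg_self {a} _ := by
    rw [hilbertSymbolInf, if_neg (by omega)]

namespace IsSymbol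

variable {H : ℤ → ℤ → ℤ} (hH : IsSymbol H)
include hH

theorem mul_right {a b b' : ℤ} (ha : a ≠ 0) (hb : b ≠ 0) (hb' : b' ≠ 0) :
    H a (b * b') = H a b * H a b' := by
  rw [hH.comm ha (mul_ne_zero hb hb'), hH.mul_left hb hb' ha, hH.comm hb ha, hH.comm hb' ha]

theorem mul_self {a b : ℤ} (ha : a ≠ 0) (hb : b ≠ 0) : H a b * H a b = 1 := by
  rcases hH.eq_one_or ha hb with h | h <;> simp [h]

/-- If `(a, b)` splits, or if it does not split and `c` is not a square, then the common slot
conditions for `(a, b)` and `c` can be solved. -/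
theorem exists_common_slot {a b c : ℤ} (ha : a ≠ 0) (hb : b ≠ 0) (hc : c ≠ 0)
    (h : H a b = 1 ∨ ∃ m ≠ 0, H m c = -1) :
    ∃ n ≠ 0, H n a = H (-b) a ∧ H n (a * c) = H a (a * c) := by
  have hb' : -b ≠ 0 := neg_ne_zero.2 hb
  have h1 : (-1 : ℤ) ≠ 0 := by simp
  have hac := mul_ne_zero ha hc
  have hab : H a a = H a b * H (-b) a := by
    have e2 := hH.mul_right ha ha h1
    have e3 := hH.mul_right ha hb h1
    have e4 := hH.neg_self ha
    rw [show a * -1 = -a by ring, e4] at e2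
    rw [show b * -1 = -b by ring] at e3
    rw [hH.comm hb' ha, e3, ← mul_assoc, hH.mul_self ha hb, one_mul]
    linear_combination -H a a * hH.mul_self ha h1 - H a (-1) * e2
  -- In the split case n = a works by `hab`. Otherwise n ↦ H(n, a) is nontrivial (at `b`), as is its
  -- product H(n, c) with H(n, ac) (at `m`). If H(n, ac) is trivial, n = -b works; if not, two
  -- distinct nontrivial quadratic characters take all four pairs of values.
  rcases hH.eq_one_or ha hb with hs | hs
  · exact ⟨a, ha, by rw [hab, hs, one_mul], rfl⟩
  obtain ⟨m, hm, hmc⟩ := h.resolve_left (by rw [hs]; norm_num)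
  have hba : H b a = -1 := by rw [hH.comm hb ha, hs]
  by_cases hg : ∀ n ≠ 0, H n (a * c) = 1
  · exact ⟨-b, hb', rfl, by rw [hg _ hb', hg _ ha]⟩
  push Not at hg
  obtain ⟨y, hy, hyc⟩ := hg
  replace hyc := (hH.eq_one_or hy hac).resolve_left hyc
  have hmac := hH.mul_right hm ha hc
  have gen : (∃ n ≠ 0, H n a = -1 ∧ H n (a * c) = 1) ∧ (∃ n ≠ 0, H n a = 1 ∧ H n (a * c) = -1) := by
    have e (u v w : ℤ) (hu : u ≠ 0) (hv : v ≠ 0) (hw : w ≠ 0) := hH.mul_left hu hv hw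
    rcases hH.eq_one_or hb hac with hbc | hbc
    · refine ⟨⟨b, hb, hba, hbc⟩, ?_⟩
      rcases hH.eq_one_or hy ha with hya | hya
      · exact ⟨y, hy, hya, hyc⟩
      · exact ⟨b * y, mul_ne_zero hb hy, by rw [e _ _ _ hb hy ha, hba, hya]; rfl,
          by rw [e _ _ _ hb hy hac, hbc, hyc]; rfl⟩
    · have hbm := mul_ne_zero hb hm
      rcases hH.eq_one_or hm ha with hma | hma <;> rw [hma, hmc] at hmac
      · exact ⟨⟨b * m, hbm, by rw [e _ _ _ hb hm ha, hba, hma]; rfl,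
          by rw [e _ _ _ hb hm hac, hbc, hmac]; rfl⟩, m, hm, hma, hmac⟩
      · exact ⟨⟨m, hm, hma, hmac⟩, b * m, hbm, by rw [e _ _ _ hb hm ha, hba, hma]; rfl,
          by rw [e _ _ _ hb hm hac, hbc, hmac]; rfl⟩
  obtain ⟨⟨u, hu, hua, huc⟩, v, hv, hva, hvc⟩ := gen
  have huv := mul_ne_zero hu hv
  have h1a : H 1 a = 1 := by
    have := hH.mul_left (one_ne_zero (α := ℤ)) one_ne_zero ha
    rw [mul_one, hH.mul_self one_ne_zero ha] at this
    exact this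
  have h1c : H 1 (a * c) = 1 := by
    have := hH.mul_left (one_ne_zero (α := ℤ)) one_ne_zero hac
    rw [mul_one, hH.mul_self one_ne_zero hac] at this
    exact this
  rcases hH.eq_one_or hb' ha with e1 | e1 <;> rcases hH.eq_one_or ha hac with e2 | e2 <;>
    rw [e1, e2]
  · exact ⟨1, one_ne_zero, h1a, h1c⟩
  · exact ⟨v, hv, hva, hvc⟩
  · exact ⟨u, hu, hua, huc⟩
  · exact ⟨u * v, huv, by rw [hH.mul_left hu hv ha, hua, hva]; rfl,
      by rw [hH.mul_left hu hv hac, huc, hvc]; rfl⟩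

/-- Both Hilbert symbols of the common slot conditions become trivial. -/
theorem trivial_of_common_slot {a b c n : ℤ} (ha : a ≠ 0) (hb : b ≠ 0) (hc : c ≠ 0) (hn : n ≠ 0)
    (h₁ : H n a = H (-b) a) (h₂ : H n (a * c) = H a (a * c)) :
    H a (-(n * b)) = 1 ∧ H (a * c) (n * a) = 1 := by
  have hb' : -b ≠ 0 := neg_ne_zero.2 hb
  have hac := mul_ne_zero ha hc
  constructor
  · rw [← mul_neg, hH.mul_right ha hn hb', hH.comm ha hn, h₁, hH.comm hb' ha, hH.mul_self ha hb']
  · rw [hH.mul_right hac hn ha, hH.comm hac hn, h₂, hH.comm hac ha, hH.mul_self ha hac]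

end IsSymbol

/-- By the product formula, one finite place may be disregarded. -/
theorem HilbertTrivial.of_forall_ne {a b : ℤ} (ha : a ≠ 0) (hb : b ≠ 0) {q : ℕ} (hq : q.Prime)
    (h : ∀ (p : ℕ) [Fact p.Prime], p ≠ q → hilbertSymbol p a b = 1)
    (hinf : hilbertSymbolInf a b = 1) : HilbertTrivial a b := by
  refine ⟨fun p hp => ?_, hinf⟩
  by_cases hpq : p = q
  swap
  · exact h p hpq
  subst hpq
  have hN : 2 * a.natAbs * b.natAbs * p ≠ 0 :=
    mul_ne_zero (mul_ne_zero (mul_ne_zero (by norm_num) (Int.natAbs_ne_zero.2 ha))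
      (Int.natAbs_ne_zero.2 hb)) hq.ne_zero
  have := productFormula ha hb _ hN ⟨a.natAbs * b.natAbs * p, by ring⟩
    (Int.dvd_natCast.2 ⟨2 * b.natAbs * p, by ring⟩) (Int.dvd_natCast.2 ⟨2 * a.natAbs * p, by ring⟩)
  rwa [hinf, one_mul, Finset.prod_eq_single p] at this
  · intro r hr hrp
    have := Fact.mk (Nat.prime_of_mem_primeFactors hr)
    exact h r hrp
  · intro h
    exact absurd (Nat.mem_primeFactors.2 ⟨hq, ⟨_, mul_comm _ _⟩, hN⟩) h

/-- Simultaneous approximation of integers at finitely many primes. -/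
theorem exists_int_modEq (s : Finset ℕ) (hs : ∀ p ∈ s, p.Prime) (e : ℕ → ℕ) (r : ℕ → ℤ) :
    ∃ N : ℤ, ∀ p ∈ s, N ≡ r p [ZMOD (p : ℤ) ^ e p] := by
  have hpos : ∀ p ∈ s, p ^ e p ≠ 0 := fun p hp => pow_ne_zero _ (hs p hp).ne_zero
  obtain ⟨k, hk⟩ := Nat.chineseRemainderOfFinset (fun p => (r p % (p ^ e p : ℕ)).toNat)
    (fun p => p ^ e p) s hpos (fun p hp q hq hpq => by
      exact Nat.Coprime.pow _ _ ((Nat.coprime_primes (hs p hp) (hs q hq)).2 hpq))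
  refine ⟨k, fun p hp => ?_⟩
  have h1 := Int.natCast_modEq_iff.2 (hk p hp)
  rw [Int.toNat_of_nonneg (Int.emod_nonneg _ (by exact_mod_cast hpos p hp))] at h1
  push_cast at h1
  exact h1.trans (Int.mod_modEq _ _)

/-- Given integers at finitely many primes and a sign, there is an integer that is close to them,
has the given sign, and has at most one further prime factor. -/
theorem exists_approx_almost_unit (s : Finset ℕ) (hs : ∀ p ∈ s, p.Prime) (e : ℕ → ℕ) (r : ℕ → ℤ)
    {σ : ℤ} (hσ : σ = 1 ∨ σ = -1) : ∃ (n : ℤ) (q : ℕ), q.Prime ∧ q ∉ s ∧ 0 < σ * n ∧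
      (∀ p ∈ s, n ≡ r p [ZMOD (p : ℤ) ^ e p]) ∧
      ∀ p : ℕ, p.Prime → p ∉ s → p ≠ q → ¬ (p : ℤ) ∣ n := by
  obtain ⟨N, hN⟩ := exists_int_modEq s hs e r
  set M : ℕ := ∏ p ∈ s, p ^ e p with hM
  have hM0 : M ≠ 0 := Finset.prod_ne_zero_iff.2 fun p hp => pow_ne_zero _ (hs p hp).ne_zero
  have hG : 0 < Int.gcd N M := Int.gcd_pos_of_ne_zero_right _ (by exact_mod_cast hM0)
  set G := Int.gcd N M with hGdef
  obtain ⟨N', hN'⟩ : (G : ℤ) ∣ N := Int.gcd_dvd_left ..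
  obtain ⟨M', hM'⟩ : G ∣ M := by exact_mod_cast Int.gcd_dvd_right N (M : ℤ)
  have hM'0 : M' ≠ 0 := by rintro rfl; simp at hM'; exact hM0 hM'
  have hσσ : σ * σ = 1 := by rcases hσ with rfl | rfl <;> norm_num
  have hcop : IsCoprime N' (M' : ℤ) := by
    have hb := Int.gcd_eq_gcd_ab N M
    refine ⟨Int.gcdA N M, Int.gcdB N M, ?_⟩
    have hG' : (G : ℤ) ≠ 0 := by exact_mod_cast hG.ne'
    apply mul_left_cancel₀ hG'
    have hMz : (M : ℤ) = G * M' := by exact_mod_cast hM'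
    rw [← hGdef] at hb
    calc (G : ℤ) * (Int.gcdA N M * N' + Int.gcdB N M * M')
        = (G * N') * Int.gcdA N M + (G * M') * Int.gcdB N M := by ring
      _ = G * 1 := by rw [← hN', ← hMz, ← hb, mul_one]
  have hcop' : IsCoprime (σ * N') (M' : ℤ) := by
    obtain ⟨u, v, huv⟩ := hcop
    exact ⟨σ * u, v, by linear_combination huv + u * N' * hσσ⟩
  -- Dirichlet's theorem is applied after removing the gcd `G` of `N` and `M`. The bound q > ∑ p
  -- keeps `q` outside `s`, and `G` has prime factors only in `s`, so σGq has `q` as its only new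
  -- prime.
  obtain ⟨q, hqgt, hqp, hq⟩ := Nat.forall_exists_prime_gt_and_zmodEq (∑ p ∈ s, p) hM'0 hcop'
  have hqs : q ∉ s := fun h => by
    have : q ≤ ∑ p ∈ s, p := Finset.single_le_sum (f := fun p : ℕ => p) (fun _ _ => Nat.zero_le _) h
    omega
  refine ⟨σ * G * q, q, hqp, hqs, ?_, ?_, ?_⟩
  · rw [← mul_assoc, ← mul_assoc, hσσ, one_mul]
    exact_mod_cast Nat.mul_pos hG hqp.pos
  · intro p hp
    have hpM : ((p : ℤ) ^ e p) ∣ M := by exact_mod_cast Finset.dvd_prod_of_mem _ hp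
    have h1 : σ * G * q ≡ N [ZMOD M] := by
      obtain ⟨k, hk⟩ := hq.symm.dvd
      refine (Int.modEq_iff_dvd.2 ⟨σ * k, ?_⟩).symm
      have hMz : (M : ℤ) = G * M' := by exact_mod_cast hM'
      rw [hMz, hN']
      linear_combination σ * G * hk + G * N' * hσσ
    exact (h1.of_dvd hpM).trans (hN p hp)
  · intro p hp hps hpq hd
    have hpp := Nat.prime_iff_prime_int.1 hp
    rcases hpp.dvd_or_dvd hd with hd | hd
    · rcases hpp.dvd_or_dvd hd with hd | hd
      · have : (p : ℤ) ∣ 1 := by rw [← hσσ]; exact hd.mul_right σ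
        exact hpp.not_isUnit (isUnit_of_dvd_one this)
      · have hdM : p ∣ M := (Int.natCast_dvd_natCast.1 hd).trans ⟨M', hM'⟩
        obtain ⟨r, hr, hd⟩ := (hp.prime.dvd_finsetProd_iff _).1 hdM
        have := (Nat.prime_dvd_prime_iff_eq hp (hs r hr)).1 (hp.dvd_of_dvd_pow hd)
        exact hps (this ▸ hr)
    · exact hpq ((Nat.prime_dvd_prime_iff_eq hp hqp).1 (Int.natCast_dvd_natCast.1 hd))

/-- An integer `c` is the square of a rational pure quaternion in `(a, b)` if it is not a square
at the places where `(a, b)` does not split. -/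
theorem exists_pure_sq_eq_of_local {a b c : ℤ} (ha : a ≠ 0) (hb : b ≠ 0) (hc : c ≠ 0)
    (hfin : ∀ (p : ℕ) [Fact p.Prime], hilbertSymbol p a b = 1 ∨ ∃ m ≠ 0, hilbertSymbol p m c = -1)
    (hinf : hilbertSymbolInf a b = 1 ∨ c < 0) :
    ∃ x y z : ℚ, a * x ^ 2 + b * y ^ 2 - a * b * z ^ 2 = c := by
  have hac := mul_ne_zero ha hc
  have hb' : -b ≠ 0 := neg_ne_zero.2 hb
  obtain ⟨m, hm0, hm₁, hm₂⟩ := isSymbol_hilbertSymbolInf.exists_common_slot ha hb hc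
    (hinf.imp_right fun h => ⟨-1, by simp, by simp [hilbertSymbolInf, h]⟩)
  have loc : ∀ p : ℕ, ∃ r ≠ 0, ∀ [Fact p.Prime], hilbertSymbol p r a = hilbertSymbol p (-b) a ∧
      hilbertSymbol p r (a * c) = hilbertSymbol p a (a * c) := by
    intro p
    by_cases hp : p.Prime
    · have := Fact.mk hp
      obtain ⟨r, hr, h⟩ := (isSymbol_hilbertSymbol p).exists_common_slot ha hb hc (hfin p)
      exact ⟨r, hr, h⟩
    · exact ⟨1, one_ne_zero, fun {h} => absurd h.out hp⟩
  choose r hr0 hr using loc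
  set D : ℕ := 2 * a.natAbs * b.natAbs * c.natAbs with hD
  have hD0 : D ≠ 0 := mul_ne_zero (mul_ne_zero (mul_ne_zero (by norm_num)
    (Int.natAbs_ne_zero.2 ha)) (Int.natAbs_ne_zero.2 hb)) (Int.natAbs_ne_zero.2 hc)
  obtain ⟨n, q, hq, hqs, hpos, hn, hnd⟩ := exists_approx_almost_unit D.primeFactors
    (fun p hp => Nat.prime_of_mem_primeFactors hp) (fun p => padicValInt p (r p) + 3) r
    (σ := m.sign) (by
      rcases hm0.lt_or_gt with h | h
      · exact Or.inr (Int.sign_eq_neg_one_of_neg h)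
      · exact Or.inl (Int.sign_eq_one_of_pos h))
  have hn0 : n ≠ 0 := by rintro rfl; simp at hpos
  have hsign : n < 0 ↔ m < 0 := by
    rcases hm0.lt_or_gt with h | h
    · rw [Int.sign_eq_neg_one_of_neg h] at hpos; omega
    · rw [Int.sign_eq_one_of_pos h] at hpos; omega
  have hI := isSymbol_hilbertSymbolInf.trivial_of_common_slot (n := n) ha hb hc hn0
    (by rw [← hm₁]; simp [hilbertSymbolInf, hsign])
    (by rw [← hm₂]; simp [hilbertSymbolInf, hsign])
  have hF : ∀ (p : ℕ) [Fact p.Prime], p ≠ q →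
      hilbertSymbol p a (-(n * b)) = 1 ∧ hilbertSymbol p (a * c) (n * a) = 1 := by
    intro p hp hpq
    by_cases hps : p ∈ D.primeFactors
    · have h1 := hilbertSymbol_congr a (hr0 p) (hn p hps)
      have h2 := hilbertSymbol_congr (a * c) (hr0 p) (hn p hps)
      exact (isSymbol_hilbertSymbol p).trivial_of_common_slot ha hb hc hn0
        (h1.2.trans (hr p).1) (h2.2.trans (hr p).2)
    · have hpD : ¬ p ∣ D := fun h => hps (Nat.mem_primeFactors.2 ⟨hp.out, h, hD0⟩)
      have h2 : p ≠ 2 := by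
        rintro rfl
        exact hpD ⟨a.natAbs * b.natAbs * c.natAbs, by rw [hD]; ring⟩
      have hpa : ¬ (p : ℤ) ∣ a := fun h => hpD ((Int.natCast_dvd.1 h).trans
        ⟨2 * b.natAbs * c.natAbs, by rw [hD]; ring⟩)
      have hpb : ¬ (p : ℤ) ∣ b := fun h => hpD ((Int.natCast_dvd.1 h).trans
        ⟨2 * a.natAbs * c.natAbs, by rw [hD]; ring⟩)
      have hpc : ¬ (p : ℤ) ∣ c := fun h => hpD ((Int.natCast_dvd.1 h).trans
        ⟨2 * a.natAbs * b.natAbs, by rw [hD]; ring⟩)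
      have hpn := hnd p hp.out hps hpq
      exact ⟨hilbertSymbol_of_not_dvd h2 hpa (by rw [Int.dvd_neg]; exact not_dvd_mul hpn hpb),
        hilbertSymbol_of_not_dvd h2 (not_dvd_mul hpa hpc) (not_dvd_mul hpn hpa)⟩
  have hnb : -(n * b) ≠ 0 := neg_ne_zero.2 (mul_ne_zero hn0 hb)
  have hna := mul_ne_zero hn0 ha
  have t₁ := isNormFrom_rat_of_hilbertTrivial ha hnb
    (HilbertTrivial.of_forall_ne ha hnb hq (fun p _ hpq => (hF p hpq).1) hI.1)
  have t₂ := isNormFrom_rat_of_hilbertTrivial hac hna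
    (HilbertTrivial.of_forall_ne hac hna hq (fun p _ hpq => (hF p hpq).2) hI.2)
  push_cast at t₁ t₂
  exact IsNormFrom.exists_pure_sq_eq (by exact_mod_cast ha) (by exact_mod_cast hb)
    (n := (n : ℚ)) (by exact_mod_cast hn0) t₁ t₂

end Existence

/-! ### Choosing two traces with nonsquare discriminants -/

section TraceChoice

open ZMod
open scoped NumberTheorySymbols

/-- The nonzero integer `c` is detected not to be a square in `ℚ_[p]` by the Hilbert symbol. -/
def IsSymbolNonsquare (p : ℕ) (c : ℤ) : Prop := c ≠ 0 ∧ ∃ m ≠ 0, hilbertSymbol p m c = -1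

variable {p : ℕ} [hp : Fact p.Prime]

namespace IsSymbolNonsquare

theorem congr {c c' : ℤ} (hc : IsSymbolNonsquare p c)
    (h : c' ≡ c [ZMOD (p : ℤ) ^ (padicValInt p c + 3)]) : IsSymbolNonsquare p c' := by
  obtain ⟨hc0, m, hm, hmc⟩ := hc
  obtain ⟨h0, h1⟩ := hilbertSymbol_congr m hc0 h
  exact ⟨h0, m, hm, by rw [hilbertSymbol_comm hm h0, h1, hilbertSymbol_comm hc0 hm, hmc]⟩

theorem of_jacobiSym (h2 : p ≠ 2) {c : ℤ} (h : J(c | p) = -1) : IsSymbolNonsquare p c := by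
  have hpc : ¬ (p : ℤ) ∣ c := by
    intro hd
    have hc : J(c | p) = J(0 | p) :=
      jacobiSym.mod_left' (by rw [Int.emod_eq_zero_of_dvd hd, Int.zero_emod])
    rw [hc, jacobiSym.zero_left hp.out.one_lt] at h
    norm_num at h
  refine ⟨by rintro rfl; simp at hpc, p, by exact_mod_cast hp.out.ne_zero, ?_⟩
  have := hilbertSymbol_pow_mul (p := p) h2 (u := 1) (by simpa using not_dvd_neg_one (p := p)) hpc 1 0
  simpa [h] using this

theorem of_eq_mul (h2 : p ≠ 2) {c w : ℤ} (hw : ¬ (p : ℤ) ∣ w) (hc : c = p * w) :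
    IsSymbolNonsquare p c := by
  obtain ⟨m, hm⟩ := FiniteField.exists_nonsquare (F := ZMod p) (by
    rwa [ZMod.ringChar_zmod_n])
  obtain ⟨m, rfl⟩ := ZMod.intCast_surjective m
  have hpm : ¬ (p : ℤ) ∣ m := by
    intro hd
    rw [(ZMod.intCast_zmod_eq_zero_iff_dvd m p).2 hd] at hm
    exact hm (IsSquare.zero)
  have hp0 : (p : ℤ) ≠ 0 := by exact_mod_cast hp.out.ne_zero
  refine ⟨hc ▸ mul_ne_zero hp0 (by rintro rfl; simp at hw), m, by rintro rfl; simp at hpm, ?_⟩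
  have := hilbertSymbol_pow_mul (p := p) h2 hpm hw 0 1
  rw [hc]
  simpa [ZMod.nonsquare_iff_jacobiSym_eq_neg_one.2 hm] using this

theorem of_mod_eight {c : ℤ} (h : c % 8 = 5) : IsSymbolNonsquare 2 c := by
  refine ⟨by omega, 2, by norm_num, ?_⟩
  have := hilbertSymbol_two_pow_mul (u := 1) (v := c) (by norm_num) (by omega) 1 0
  have h4 : χ₄ ((1 : ℤ) : ZMod 4) ≠ -1 := by decide
  rw [χ₈_int_mod_eight c, h, if_neg h4] at this
  simpa using this

theorem of_mod_sixteen {c : ℤ} (h : c % 16 = 12) : IsSymbolNonsquare 2 c := by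
  obtain ⟨w, rfl⟩ : ∃ w, c = 2 ^ 2 * w := ⟨c / 4, by omega⟩
  refine ⟨by omega, -1, by norm_num, ?_⟩
  have := hilbertSymbol_two_pow_mul (u := -1) (v := w) (by norm_num) (by omega) 0 2
  have h4 : χ₄ ((-1 : ℤ) : ZMod 4) = -1 := by decide
  have h8 : χ₈ ((-1 : ℤ) : ZMod 8) = 1 := by decide
  rw [if_pos h4, h8, χ₄_int_three_mod_four (by omega)] at this
  simpa using this

end IsSymbolNonsquare

/-- `y ^ 2 - 4` is not a square in `ℚ_[p]`, stably under small perturbations. -/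
def IsNonsplitTrace (p : ℕ) (y : ℤ) : Prop :=
  ∀ c r : ℤ, ¬ (p : ℤ) ∣ r → c ≡ r ^ 2 * (y ^ 2 - 4) [ZMOD (p : ℤ) ^ 4] → IsSymbolNonsquare p c

namespace IsNonsplitTrace

theorem of_not_isSquare (h2 : p ≠ 2) {y : ℤ} (h : ¬ IsSquare ((y : ZMod p) ^ 2 - 4)) :
    IsNonsplitTrace p y := by
  intro c r hr hc
  apply IsSymbolNonsquare.of_jacobiSym h2
  rw [jacobiSym.mod_left' (hc.of_dvd (dvd_pow_self _ (by norm_num))), jacobiSym.mul_left,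
    jacobiSym.sq_one' (gcd_eq_one_of_not_dvd hr), one_mul,
    ZMod.nonsquare_iff_jacobiSym_eq_neg_one]
  exact_mod_cast h

/-- Here y² - 4 = pu(pu - 4) has valuation exactly 1. -/
theorem neg_two_add (h2 : p ≠ 2) {u : ℤ} (hu : ¬ (p : ℤ) ∣ u) :
    IsNonsplitTrace p (-2 + p * u) := by
  intro c r hr hc
  obtain ⟨k, hk⟩ := hc.symm.dvd
  refine IsSymbolNonsquare.of_eq_mul h2 (w := r ^ 2 * u * (-4) + p * (r ^ 2 * u ^ 2 + p ^ 2 * k)) ?_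
    (by linear_combination hk)
  intro hd
  have h2' : ¬ (p : ℤ) ∣ 2 := by
    exact_mod_cast ProductFormula.not_dvd_natCast hp.out Nat.prime_two h2
  have h4 : ¬ (p : ℤ) ∣ -4 := by rw [Int.dvd_neg]; exact not_dvd_mul h2' h2'
  rw [sq] at hd
  refine not_dvd_mul (not_dvd_mul (not_dvd_mul hr hr) hu) h4 ?_
  exact (Int.dvd_add_left (dvd_mul_right _ _)).1 hd

theorem two_of_odd {y : ℤ} (hy : y % 2 = 1) : IsNonsplitTrace 2 y := by
  intro c r hr hc
  apply IsSymbolNonsquare.of_mod_eight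
  obtain ⟨z, rfl⟩ : ∃ z, y = 2 * z + 1 := ⟨y / 2, by omega⟩
  obtain ⟨w, rfl⟩ : ∃ w, r = 2 * w + 1 := ⟨r / 2, by push_cast at hr; omega⟩
  have h8 := hc.of_dvd (show (8 : ℤ) ∣ ((2 : ℕ) : ℤ) ^ 4 by norm_num)
  have e : ∀ W Z : ZMod 8, (2 * W + 1) ^ 2 * ((2 * Z + 1) ^ 2 - 4) = 5 := by decide
  have := e w z
  have h5 : (((2 * w + 1) ^ 2 * ((2 * z + 1) ^ 2 - 4) : ℤ) : ZMod 8) = ((5 : ℤ) : ZMod 8) := by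
    push_cast; exact this
  exact h8.trans ((ZMod.intCast_eq_intCast_iff _ _ 8).1 h5)

/-- The relevant number is -4 times an odd square, detected by the symbol with -1. This case needs
congruence modulo 16, hence the exponent 4 in `IsNonsplitTrace`. -/
theorem two_zero : IsNonsplitTrace 2 0 := by
  intro c r hr hc
  apply IsSymbolNonsquare.of_mod_sixteen
  obtain ⟨w, rfl⟩ : ∃ w, r = 2 * w + 1 := ⟨r / 2, by push_cast at hr; omega⟩
  have e : ∀ W : ZMod 16, (2 * W + 1) ^ 2 * (0 ^ 2 - 4) = 12 := by decide
  have h5 : (((2 * w + 1) ^ 2 * (0 ^ 2 - 4) : ℤ) : ZMod 16) = ((12 : ℤ) : ZMod 16) := by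
    push_cast; exact e w
  have h16 := hc.of_dvd (show (16 : ℤ) ∣ ((2 : ℕ) : ℤ) ^ 4 by norm_num)
  exact h16.trans ((ZMod.intCast_eq_intCast_iff _ _ 16).1 h5)

/-- Modulo an odd prime, every element is a sum of two elements `x` such that either `x = -2` or
`x ^ 2 - 4` is not a square. -/
theorem exists_zmod_add (h2 : p ≠ 2) (τ : ZMod p) : ∃ x y : ZMod p, x + y = τ ∧
    (x = -2 ∨ ¬ IsSquare (x ^ 2 - 4)) ∧ (y = -2 ∨ ¬ IsSquare (y ^ 2 - 4)) := by
  classical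
  obtain ⟨d, hd⟩ := FiniteField.exists_nonsquare (F := ZMod p) (by rwa [ZMod.ringChar_zmod_n])
  have hd0 : d ≠ 0 := by rintro rfl; exact hd IsSquare.zero
  have h20 : (2 : ZMod p) ≠ 0 := Ring.two_ne_zero (by rwa [ZMod.ringChar_zmod_n])
  have hrd : ∀ r : ZMod p, r ^ 2 - d ≠ 0 := fun r h => hd ⟨r, by linear_combination -h⟩
  -- `f r` is the trace of (r + √d)/(r - √d), a norm-one element of the quadratic extension of the
  -- residue field. Hence f(r)² - 4 = 16 d r²/(r² - d)², a nonsquare unless r = 0, where f(r) = -2.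
  set f : ZMod p → ZMod p := fun r => 2 + 4 * d / (r ^ 2 - d) with hf
  have hfr : ∀ r, f r = -2 ∨ ¬ IsSquare (f r ^ 2 - 4) := by
    intro r
    by_cases hr : r = 0
    · left
      simp only [hf, hr]
      rw [show (0 : ZMod p) ^ 2 - d = -d by ring]
      field_simp
      ring
    · right
      rintro ⟨e, he⟩
      apply hd
      have := hrd r
      refine ⟨e * (r ^ 2 - d) / (4 * r), ?_⟩
      have h40 : (4 : ZMod p) ≠ 0 := by
        rw [show (4 : ZMod p) = 2 * 2 by norm_num]; exact mul_ne_zero h20 h20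
      have key : 16 * d * r ^ 2 = (f r ^ 2 - 4) * (r ^ 2 - d) ^ 2 := by
        simp only [hf]; field_simp; ring
      rw [he] at key
      field_simp
      linear_combination key
  set X := Finset.univ.image f with hX
  set sqs := Finset.univ.image fun r : ZMod p => Polynomial.eval r (.X ^ 2) with hsqs
  have hcard : p ≤ 2 * sqs.card := by
    have := FiniteField.card_image_polynomial_eval (R := ZMod p) (p := .X ^ 2) (by simp)
    rwa [Polynomial.natDegree_X_pow, ZMod.card] at this
  have hXc : sqs.card ≤ X.card := by
    have : sqs.image (fun z => 2 + 4 * d / (z - d)) ⊆ X := by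
      intro x hx
      simp only [hsqs, Finset.mem_image, Finset.mem_univ, true_and, exists_exists_eq_and] at hx
      obtain ⟨r, rfl⟩ := hx
      exact Finset.mem_image.2 ⟨r, Finset.mem_univ _, by simp [hf]⟩
    refine le_trans (Finset.card_image_of_injOn ?_).ge (Finset.card_le_card this)
    intro z hz w hw hzw
    simp only [hsqs, Finset.coe_image, Set.mem_image, Finset.coe_univ, Set.mem_univ, true_and]
      at hz hw
    obtain ⟨z, rfl⟩ := hz
    obtain ⟨w, rfl⟩ := hw
    simp only [Polynomial.eval_pow, Polynomial.eval_X, add_right_inj] at hzw ⊢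
    have h1 := hrd z
    have h2 := hrd w
    have h40 : (4 * d : ZMod p) ≠ 0 := by
      rw [show (4 : ZMod p) = 2 * 2 by norm_num]; exact mul_ne_zero (mul_ne_zero h20 h20) hd0
    rw [div_eq_div_iff h1 h2] at hzw
    have := mul_left_cancel₀ h40 hzw
    linear_combination -this
  -- `f r` is an injective function of r², so `X` has at least (p + 1)/2 elements and must meet τ -
  -- X.
  have hodd := hp.out.odd_of_ne_two h2
  obtain ⟨x, hx⟩ := Finset.inter_nonempty_of_card_lt_card_add_card (s := Finset.univ) (t := X)
    (u := X.image fun x => τ - x) (Finset.subset_univ _) (Finset.subset_univ _) (by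
      rw [Finset.card_image_of_injective _ sub_right_injective, Finset.card_univ, ZMod.card]
      obtain ⟨k, hk⟩ := hodd
      omega)
  simp only [Finset.mem_inter, hX, Finset.mem_image, Finset.mem_univ, true_and,
    exists_exists_eq_and] at hx
  obtain ⟨⟨r, rfl⟩, q, hq⟩ := hx
  exact ⟨f r, f q, by rw [← hq]; ring, hfr r, hfr q⟩

theorem exists_add (p : ℕ) [hp : Fact p.Prime] (τ : ℤ) :
    ∃ s y : ℤ, s + y = τ ∧ IsNonsplitTrace p s ∧ IsNonsplitTrace p y := by
  by_cases h2 : p = 2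
  · subst h2
    rcases Int.emod_two_eq_zero_or_one τ with h | h
    · exact ⟨1, τ - 1, by ring, two_of_odd (by norm_num), two_of_odd (by omega)⟩
    · exact ⟨0, τ, by ring, two_zero, two_of_odd h⟩
  have h1 : ¬ (p : ℤ) ∣ 1 := by simpa using not_dvd_neg_one (p := p)
  have mixed : ∀ x : ZMod p, x + -2 = τ → ¬ IsSquare (x ^ 2 - 4) →
      ∃ s y : ℤ, s + y = τ ∧ IsNonsplitTrace p s ∧ IsNonsplitTrace p y := by
    intro x hx hns
    refine ⟨τ - (-2 + p * 1), -2 + p * 1, by ring, of_not_isSquare h2 ?_, neg_two_add h2 h1⟩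
    have : ((τ - (-2 + p * 1) : ℤ) : ZMod p) = x := by push_cast; rw [← hx]; simp
    rwa [this]
  obtain ⟨x, y, hxy, hx, hy⟩ := exists_zmod_add h2 (τ : ZMod p)
  rcases hx with rfl | hx
  · rcases hy with rfl | hy
    · obtain ⟨u, hu⟩ := (ZMod.intCast_zmod_eq_zero_iff_dvd (τ + 4) p).1
        (by push_cast; rw [← hxy]; ring)
      have h2' : ¬ (p : ℤ) ∣ 2 := by
        exact_mod_cast ProductFormula.not_dvd_natCast hp.out Nat.prime_two h2
      -- Both summands have the form -2 + p · (unit), so `u` must be a sum of two integers prime to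
      -- p: 1 + (u - 1), or 2 + (u - 2) if p divides u - 1.
      by_cases hu1 : (p : ℤ) ∣ u - 1
      · refine ⟨-2 + p * 2, -2 + p * (u - 2), by linear_combination -hu, neg_two_add h2 h2',
          neg_two_add h2 fun h => h1 ?_⟩
        have := dvd_sub hu1 h
        rwa [show u - 1 - (u - 2) = 1 by ring] at this
      · exact ⟨-2 + p * 1, -2 + p * (u - 1), by linear_combination -hu, neg_two_add h2 h1,
          neg_two_add h2 hu1⟩
    · exact mixed y (by rw [← hxy]; ring) hy
  · rcases hy with rfl | hy
    · exact mixed x hxy hx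
    · obtain ⟨s, rfl⟩ := ZMod.intCast_surjective x
      refine ⟨s, τ - s, by ring, of_not_isSquare h2 hx, of_not_isSquare h2 ?_⟩
      have : ((τ - s : ℤ) : ZMod p) = y := by push_cast; rw [← hxy]; ring
      rwa [this]

end IsNonsplitTrace

/-- One decomposes t₁/t₂ modulo p⁴, using an inverse `u` of `t₂`, and clears the denominator. The
factor r² in `IsNonsplitTrace` absorbs the resulting t₂². -/
theorem exists_local_trace (p : ℕ) [hp : Fact p.Prime] (t₁ : ℤ) {t₂ : ℤ} (h : ¬ (p : ℤ) ∣ t₂) :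
    ∃ s : ℤ, IsSymbolNonsquare p (s ^ 2 - 4) ∧
      IsSymbolNonsquare p ((t₁ - s * t₂) ^ 2 - 4 * t₂ ^ 2) := by
  have hcop : IsCoprime t₂ ((p : ℤ) ^ 4) :=
    (Int.isCoprime_iff_gcd_eq_one.2 (gcd_eq_one_of_not_dvd h)).pow_right
  obtain ⟨u, v, huv⟩ := hcop
  obtain ⟨s, y, hsy, hs, hy⟩ := IsNonsplitTrace.exists_add p (t₁ * u)
  refine ⟨s, hs _ 1 (by simpa using not_dvd_neg_one (p := p)) (by rw [one_pow, one_mul]),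
    hy _ t₂ h ?_⟩
  have h1 : t₁ - s * t₂ ≡ y * t₂ [ZMOD (p : ℤ) ^ 4] := by
    refine (Int.modEq_iff_dvd.2 ⟨t₁ * v, ?_⟩).symm
    linear_combination (-t₁) * huv - t₂ * hsy
  have := (h1.pow 2).sub_right (4 * t₂ ^ 2)
  rwa [show (y * t₂) ^ 2 - 4 * t₂ ^ 2 = t₂ ^ 2 * (y ^ 2 - 4) by ring] at this

/-- A rational `t` that is integral at finitely many primes is the sum of two rationals `s` such
that `s ^ 2 - 4` is nonsquare at these primes; one of them may be chosen close to a given real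
number. -/
theorem exists_global_trace (R : Finset ℕ) (hR : ∀ p ∈ R, p.Prime) (t₁ t₂ : ℤ)
    (h : ∀ p ∈ R, ¬ (p : ℤ) ∣ t₂) (x : ℚ) {δ : ℚ} (hδ : 0 < δ) :
    ∃ S N : ℤ, 0 < N ∧ |S / N - x| < δ ∧ ∀ p ∈ R, IsSymbolNonsquare p (S ^ 2 - 4 * N ^ 2) ∧
      IsSymbolNonsquare p ((t₁ * N - S * t₂) ^ 2 - 4 * (t₂ * N) ^ 2) := by
  have loc : ∀ p : ℕ, ∃ s : ℤ, p ∈ R → IsSymbolNonsquare p (s ^ 2 - 4) ∧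
      IsSymbolNonsquare p ((t₁ - s * t₂) ^ 2 - 4 * t₂ ^ 2) := by
    intro p
    by_cases hp : p ∈ R
    · have := Fact.mk (hR p hp)
      obtain ⟨s, hs⟩ := exists_local_trace p t₁ (h p hp)
      exact ⟨s, fun _ => hs⟩
    · exact ⟨0, fun h => absurd h hp⟩
  choose s hs using loc
  set e : ℕ → ℕ := fun p => max (padicValInt p ((s p) ^ 2 - 4))
    (padicValInt p ((t₁ - s p * t₂) ^ 2 - 4 * t₂ ^ 2)) + 3 with he
  obtain ⟨s₀, hs₀⟩ := exists_int_modEq R hR e s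
  set M : ℕ := ∏ p ∈ R, p ^ e p with hM
  have hM0 : 0 < M := Finset.prod_pos fun p hp => pow_pos (hR p hp).pos _
  have hMQ : (0 : ℚ) < M := by exact_mod_cast hM0
  obtain ⟨L, hL⟩ := exists_nat_gt (1 / δ)
  have hLpos : (0 : ℚ) < L := (by positivity : (0 : ℚ) < 1 / δ).trans hL
  -- N ≡ 1 modulo M keeps S/N close to the local choices, while S may vary in steps of M. Since M/N
  -- < δ, some step lands within δ of `x`.
  set N : ℤ := M * L + 1 with hN
  have hNQ : (N : ℚ) = M * L + 1 := by rw [hN]; push_cast; ring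
  have hN0 : (0 : ℚ) < N := by rw [hNQ]; positivity
  set k : ℤ := ⌊(N * x - s₀) / M⌋ with hk
  refine ⟨s₀ + M * k, N, by exact_mod_cast hN0, ?_, fun p hp => ?_⟩
  · have h1 := Int.floor_le ((N * x - s₀) / M)
    have h2 := Int.lt_floor_add_one ((N * x - s₀) / M)
    rw [← hk] at h1 h2
    rw [le_div_iff₀ hMQ] at h1
    rw [div_lt_iff₀ hMQ] at h2
    have h3 : (M : ℚ) < δ * N := by
      rw [hNQ]
      rw [div_lt_iff₀ hδ] at hL
      nlinarith
    have h4 : ((s₀ + M * k : ℤ) : ℚ) / N - x = (s₀ + M * k - N * x) / N := by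
      field_simp
      push_cast
      ring
    rw [h4, abs_div, abs_of_pos hN0, div_lt_iff₀ hN0, abs_lt]
    constructor <;> nlinarith
  · have := Fact.mk (hR p hp)
    have hpM : ((p : ℤ) ^ e p) ∣ M := by exact_mod_cast Finset.dvd_prod_of_mem _ hp
    have hS : s₀ + M * k ≡ s p [ZMOD (p : ℤ) ^ e p] := by
      refine Int.ModEq.trans ?_ (hs₀ p hp)
      exact (Int.modEq_iff_dvd.2 ((hpM.mul_right k).trans ⟨1, by ring⟩)).symm
    have hN1 : N ≡ 1 [ZMOD (p : ℤ) ^ e p] :=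
      (Int.modEq_iff_dvd.2 ((hpM.mul_right L).trans ⟨1, by rw [hN]; ring⟩)).symm
    obtain ⟨g1, g2⟩ := hs p hp
    constructor
    · refine g1.congr (Int.ModEq.of_dvd (pow_dvd_pow _ (show _ ≤ e p by simp [he])) ?_)
      have := (hS.pow 2).sub ((hN1.pow 2).mul_left 4)
      simpa using this
    · refine g2.congr (Int.ModEq.of_dvd (pow_dvd_pow _ (show _ ≤ e p by simp [he])) ?_)
      have := (((hN1.mul_left t₁).sub (hS.mul_right t₂)).pow 2).sub
        (((hN1.mul_left t₂).pow 2).mul_left 4)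
      simpa using this

end TraceChoice

/-! ### The two inclusions -/

section Main

/-- The integer `a.num * a.den` lies in the square class of the rational number `a`. -/
theorem num_mul_den_eq (a : ℚ) : ((a.num * a.den : ℤ) : ℚ) = a * (a.den : ℚ) ^ 2 := by
  push_cast
  rw [sq, ← mul_assoc, Rat.mul_den_eq_num]

theorem num_mul_den_ne_zero {a : ℚ} (ha : a ≠ 0) : a.num * a.den ≠ 0 :=
  mul_ne_zero (Rat.num_ne_zero.2 ha) (by exact_mod_cast a.den_ne_zero)

theorem splitsOver_iff_num_mul_den {K : Type} [Field K] [Algebra ℚ K] {a b : ℚ} (ha : a ≠ 0)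
    (hb : b ≠ 0) : SplitsOver a b K ↔
      IsNormFrom ((a.num * a.den : ℤ) : K) ((b.num * b.den : ℤ) : K) := by
  have : CharZero K := algebraRat.charZero K
  have cast (c : ℚ) : ((c.num * c.den : ℤ) : K) = (c : K) * (c.den : K) ^ 2 := by
    have := congrArg (fun q : ℚ => (q : K)) (num_mul_den_eq c)
    push_cast at this ⊢
    exact this
  rw [splitsOver_iff_isNormFrom a b ha hb, cast, cast, IsNormFrom.mul_sq_iff,
    IsNormFrom.sq_mul_left_iff]
  · exact_mod_cast a.den_ne_zero
  · exact_mod_cast b.den_ne_zero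

theorem splitsAt_finite_iff {a b : ℚ} (ha : a ≠ 0) (hb : b ≠ 0) (p : Nat.Primes) :
    SplitsAt a b (.finite p) ↔ hilbertSymbol p (a.num * a.den) (b.num * b.den) = 1 := by
  have : Fact (p : ℕ).Prime := ⟨p.2⟩
  rw [← isNormFrom_padic_iff (num_mul_den_ne_zero ha) (num_mul_den_ne_zero hb)]
  exact splitsOver_iff_num_mul_den ha hb

theorem splitsAt_infinite_iff {a b : ℚ} (ha : a ≠ 0) (hb : b ≠ 0) :
    SplitsAt a b .infinite ↔ hilbertSymbolInf (a.num * a.den) (b.num * b.den) = 1 := by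
  rw [← isNormFrom_real_iff (num_mul_den_ne_zero ha) (num_mul_den_ne_zero hb)]
  exact splitsOver_iff_num_mul_den ha hb

/-- If `s` is the trace of a norm-one element and `s ^ 2 - 4` is a nonzero square in an extension
`K` of `ℚ`, then `K` splits the quaternion algebra. -/
theorem splitsOver_of_mem_traceSet {K : Type} [Field K] [Algebra ℚ K] {a b s : ℚ} (ha : a ≠ 0)
    (hb : b ≠ 0) (hs : s ∈ traceSet a b) (h0 : s ^ 2 ≠ 4) (h : IsSquare ((s : K) ^ 2 - 4)) :
    SplitsOver a b K := by
  have : CharZero K := algebraRat.charZero K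
  obtain ⟨x₁, x₂, x₃, x₄, hx, rfl⟩ := hs
  obtain ⟨d, hd⟩ := h
  rw [splitsOver_iff_isNormFrom a b ha hb]
  have hx' := congrArg (fun q : ℚ => (q : K)) hx
  push_cast at hx' hd
  -- Since x₁² - 1 = (s² - 4)/4 = (d/2)², replacing x₁ by d/2 lowers the norm from 1 to 0.
  refine IsNormFrom.of_isotropic (x := d / 2) (y := x₂) (z := x₃) (w := x₄)
    (by exact_mod_cast ha) (by linear_combination hx' - hd / 4) (Or.inl ?_)
  intro hd0
  have hd0' : d = 0 := by simpa using hd0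
  rw [hd0'] at hd
  apply h0
  have : ((2 * x₁ : ℚ) : K) ^ 2 = (4 : ℚ) := by push_cast; linear_combination hd
  exact_mod_cast this

theorem one_lt_norm_of_dvd_den {p : ℕ} [hp : Fact p.Prime] {q : ℚ} (h : p ∣ q.den) :
    1 < ‖(q : ℚ_[p])‖ := by
  by_contra! hq
  have hnum : ¬ (p : ℤ) ∣ q.num := fun hn => by
    have := Nat.dvd_gcd (Int.natCast_dvd.1 hn) h
    rw [q.reduced.gcd_eq_one] at this
    exact hp.out.one_lt.ne' (Nat.dvd_one.1 this)
  have hden : ‖(q.den : ℚ_[p])‖ < 1 := by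
    have := (Padic.norm_intCast_lt_one_iff (p := p) (k := q.den)).2 (by exact_mod_cast h)
    simpa using this
  have h1 := congrArg (fun r : ℚ => ‖(r : ℚ_[p])‖) (Rat.mul_den_eq_num q)
  simp only [Rat.cast_mul, Rat.cast_natCast, Rat.cast_intCast, norm_mul] at h1
  rw [norm_intCast_eq_one hnum] at h1
  nlinarith [norm_nonneg (q : ℚ_[p]), norm_nonneg (q.den : ℚ_[p])]

theorem norm_le_one_of_mem_traceSet {p : ℕ} [hp : Fact p.Prime] {a b s : ℚ} (ha : a ≠ 0)
    (hb : b ≠ 0) (hns : ¬ SplitsOver a b ℚ_[p]) (hs : s ∈ traceSet a b) :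
    ‖(s : ℚ_[p])‖ ≤ 1 := by
  by_contra! h
  have hs0 : (s : ℚ_[p]) ≠ 0 := by
    intro h0
    rw [h0, norm_zero] at h
    linarith
  refine hns (splitsOver_of_mem_traceSet ha hb hs ?_ ?_)
  · intro h4
    have h4' : (s : ℚ_[p]) ^ 2 = (4 : ℤ) := by exact_mod_cast congrArg (fun q : ℚ => (q : ℚ_[p])) h4
    have := congrArg norm h4'
    rw [norm_pow] at this
    have := Padic.norm_int_le_one (p := p) 4
    nlinarith
  · obtain ⟨r, hr⟩ := isSquare_one_add_four_mul (p := p) (w := -1 / (s : ℚ_[p]) ^ 2) (by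
      rw [norm_div, norm_neg, norm_one, norm_pow]
      exact (div_lt_one (by positivity)).2 (one_lt_pow₀ h two_ne_zero))
    refine ⟨s * r, ?_⟩
    have : (s : ℚ_[p]) * r * (s * r) = s ^ 2 * (r * r) := by ring
    rw [this, ← hr]
    field_simp
    ring

theorem abs_le_two_of_mem_traceSet {a b s : ℚ} (ha : a ≠ 0) (hb : b ≠ 0)
    (hns : ¬ SplitsOver a b ℝ) (hs : s ∈ traceSet a b) : |s| ≤ 2 := by
  by_contra! h
  have h4 : 4 < s ^ 2 := by
    rw [← sq_abs]
    nlinarith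
  have h4' : (4 : ℝ) < (s : ℝ) ^ 2 := by exact_mod_cast h4
  exact hns (splitsOver_of_mem_traceSet ha hb hs h4.ne'
    (Real.isSquare_iff.2 (by linarith)))

theorem traceSumSet_subset {a b : ℚ} (ha : a ≠ 0) (hb : b ≠ 0) :
    traceSumSet a b ⊆ ⋂ v ∈ ramifiedPlaces a b, localIntegers v := by
  rintro _ ⟨s, hs, s', hs', rfl⟩
  simp only [Set.mem_iInter]
  intro v hv
  cases v with
  | infinite =>
    have h1 := abs_le.1 (abs_le_two_of_mem_traceSet ha hb hv hs)
    have h2 := abs_le.1 (abs_le_two_of_mem_traceSet ha hb hv hs')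
    exact ⟨by linarith, by linarith⟩
  | finite p =>
    have : Fact (p : ℕ).Prime := ⟨p.2⟩
    have h1 := norm_le_one_of_mem_traceSet (p := p) ha hb hv hs
    have h2 := norm_le_one_of_mem_traceSet (p := p) ha hb hv hs'
    intro hd
    refine (one_lt_norm_of_dvd_den hd).not_ge ?_
    push_cast
    exact (Padic.nonarchimedean _ _).trans (max_le h1 h2)

/-- The criterion for membership in the set of traces in terms of integral data. -/
theorem mem_traceSet_of_symbols {a b : ℚ} (ha : a ≠ 0) (hb : b ≠ 0) {s : ℚ} {c N : ℤ}
    (hN : N ≠ 0) (hc : (c : ℚ) = (s ^ 2 - 4) * N ^ 2)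
    (hfin : ∀ p : Nat.Primes, ¬ SplitsAt a b (.finite p) → IsSymbolNonsquare p c)
    (hinf : ¬ SplitsAt a b .infinite → c < 0) : s ∈ traceSet a b := by
  have hNQ : (N : ℚ) ≠ 0 := by exact_mod_cast hN
  by_cases hc0 : c = 0
  · refine ⟨s / 2, 0, 0, 0, ?_, by ring⟩
    have : s ^ 2 - 4 = 0 := by simpa [hc0, hNQ] using hc.symm
    linear_combination this / 4
  obtain ⟨x, y, z, h⟩ := exists_pure_sq_eq_of_local (num_mul_den_ne_zero ha)
    (num_mul_den_ne_zero hb) hc0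
    (fun p hp => by
      by_cases h : SplitsAt a b (.finite ⟨p, hp.out⟩)
      · exact Or.inl ((splitsAt_finite_iff ha hb _).1 h)
      · exact Or.inr (hfin _ h).2)
    (by
      by_cases h : SplitsAt a b .infinite
      · exact Or.inl ((splitsAt_infinite_iff ha hb).1 h)
      · exact Or.inr (hinf h))
  rw [num_mul_den_eq, num_mul_den_eq, hc] at h
  -- The denominators return from the integral representatives to `a` and `b`; division by 2N makes
  -- the square of the pure part (s² - 4)/4.
  refine ⟨s / 2, a.den * x / (2 * N), b.den * y / (2 * N), a.den * b.den * z / (2 * N), ?_, by ring⟩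
  field_simp
  linear_combination -h

theorem subset_traceSumSet {a b : ℚ} (ha : a ≠ 0) (hb : b ≠ 0) :
    ⋂ v ∈ ramifiedPlaces a b, localIntegers v ⊆ traceSumSet a b := by
  intro t ht
  simp only [Set.mem_iInter] at ht
  have two_mem : (2 : ℚ) ∈ traceSet a b := ⟨1, 0, 0, 0, by ring, by ring⟩
  have neg_two_mem : (-2 : ℚ) ∈ traceSet a b := ⟨-1, 0, 0, 0, by ring, by ring⟩
  -- At t = ±4 no open interval around t/2 keeps both summands in [-2, 2], so these endpoints are
  -- excluded from the approximation.
  by_cases h4 : t = 4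
  · exact ⟨2, two_mem, 2, two_mem, by rw [h4]; norm_num⟩
  by_cases h4' : t = -4
  · exact ⟨-2, neg_two_mem, -2, neg_two_mem, by rw [h4']; norm_num⟩
  set A := a.num * a.den with hA
  set B := b.num * b.den with hB
  have hA0 : A ≠ 0 := num_mul_den_ne_zero ha
  have hB0 : B ≠ 0 := num_mul_den_ne_zero hb
  -- R contains every ramified prime, because those divide 2AB and `t` is integral there. Further
  -- primes in it only add harmless conditions.
  set R : Finset ℕ := (2 * A.natAbs * B.natAbs).primeFactors.filter
    fun p => ¬ (p ∣ t.den) with hR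
  have hD0 : 2 * A.natAbs * B.natAbs ≠ 0 := mul_ne_zero (mul_ne_zero (by norm_num)
    (Int.natAbs_ne_zero.2 hA0)) (Int.natAbs_ne_zero.2 hB0)
  have mem_R : ∀ p : Nat.Primes, ¬ SplitsAt a b (.finite p) → (p : ℕ) ∈ R := by
    intro p hp
    have hden := ht _ hp
    rw [splitsAt_finite_iff ha hb] at hp
    refine Finset.mem_filter.2 ⟨Nat.mem_primeFactors.2 ⟨p.2, ?_, hD0⟩, hden⟩
    by_contra hd
    refine hp (hilbertSymbol_of_not_dvd ?_ ?_ ?_)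
    · intro h2
      exact hd (h2 ▸ ⟨A.natAbs * B.natAbs, by ring⟩)
    · exact fun h => hd ((Int.natCast_dvd.1 h).trans ⟨2 * B.natAbs, by ring⟩)
    · exact fun h => hd ((Int.natCast_dvd.1 h).trans ⟨2 * A.natAbs, by ring⟩)
  -- A rational within 2 - |t|/2 of t/2, and its complement to `t`, both lie in (-2, 2). The default
  -- 1 is used only when the infinite place splits.
  set δ : ℚ := if |t| < 4 then 2 - |t| / 2 else 1 with hδ
  have hδ0 : 0 < δ := by
    rw [hδ]
    split_ifs with h
    · linarith
    · norm_num
  obtain ⟨S, N, hN, hSN, hSym⟩ := exists_global_trace R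
    (fun p hp => Nat.prime_of_mem_primeFactors (Finset.mem_filter.1 hp).1) t.num t.den
    (fun p hp => by
      rw [Int.natCast_dvd_natCast]
      exact (Finset.mem_filter.1 hp).2) (t / 2) hδ0
  have hNQ : (0 : ℚ) < N := by exact_mod_cast hN
  have hdenQ : (0 : ℚ) < t.den := by exact_mod_cast t.den_pos
  have htd := Rat.mul_den_eq_num t
  have c₁ : ((S ^ 2 - 4 * N ^ 2 : ℤ) : ℚ) = ((S / N : ℚ) ^ 2 - 4) * N ^ 2 := by
    push_cast
    field_simp
  have c₂ : (((t.num * N - S * t.den) ^ 2 - 4 * (t.den * N) ^ 2 : ℤ) : ℚ) =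
      ((t - S / N : ℚ) ^ 2 - 4) * ((t.den * N : ℤ) : ℚ) ^ 2 := by
    push_cast
    rw [← htd]
    field_simp
  have inf : ¬ SplitsAt a b .infinite → |(S / N : ℚ)| < 2 ∧ |(t - S / N : ℚ)| < 2 := by
    intro h
    have htI := ht _ h
    have ht4 : |t| < 4 := lt_of_le_of_ne (abs_le.2 htI) fun h => by
      rcases eq_or_eq_neg_of_abs_eq h with h | h
      · exact h4 h
      · exact h4' h
    rw [hδ, if_pos ht4] at hSN
    obtain ⟨h1, h2⟩ := abs_lt.1 hSN
    have h3 := le_abs_self t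
    have h5 := neg_abs_le t
    constructor <;> rw [abs_lt] <;> constructor <;> linarith
  have neg_of {u : ℚ} {c M : ℤ} (hM : M ≠ 0) (hu : |u| < 2)
      (hc : (c : ℚ) = (u ^ 2 - 4) * (M : ℚ) ^ 2) : c < 0 := by
    have hM2 : (0 : ℚ) < (M : ℚ) ^ 2 := by positivity
    have : u ^ 2 < 4 := by
      rw [← sq_abs]
      nlinarith [abs_nonneg u]
    have : (c : ℚ) < 0 := by
      rw [hc]
      exact mul_neg_of_neg_of_pos (by linarith) hM2
    exact_mod_cast this
  have hdN : (t.den * N : ℤ) ≠ 0 := mul_ne_zero (by exact_mod_cast t.den_ne_zero) hN.ne'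
  refine ⟨S / N, ?_, t - S / N, ?_, by ring⟩
  · exact mem_traceSet_of_symbols ha hb hN.ne' c₁ (fun p hp => (hSym p (mem_R p hp)).1)
      fun h => neg_of hN.ne' (inf h).1 c₁
  · exact mem_traceSet_of_symbols ha hb hdN c₂ (fun p hp => (hSym p (mem_R p hp)).2)
      fun h => neg_of hdN (inf h).2 c₂

end Main

theorem mainTheorem7 (a b : ℚ) (ha : a ≠ 0) (hb : b ≠ 0) :
    (traceSumSet a b = ⋂ v ∈ ramifiedPlaces a b, localIntegers v) ∧
      (ramifiedPlaces a b = ∅ → traceSumSet a b = Set.univ) := by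
  have h := (traceSumSet_subset ha hb).antisymm (subset_traceSumSet ha hb)
  exact ⟨h, fun h0 => by rw [h, h0]; simp⟩
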